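/- Let $N\ge 1$ and let $X$ be an $N\times N$ GUE random matrix, i.e. a random variable on a probability space $(\Omega,\mathcal F,\mathbb P)$ with values in the Hermitian complex $N\times N$ matrices such that the family consisting of $X_{i,i}$ ($1\le i\le N$) and $\sqrt2\,\mathrm{Re}(X_{i,j})$, $\sqrt2\,\mathrm{Im}(X_{i,j})$ ($1\le i<j\le N$) is a family of independent standard Gaussian $\mathcal N(0,1)$ random variables. The exchangeable spectrum of $X$ is the vector of the $N$ eigenvalues of $X$, listed with multiplicity, viewed as an exchangeable random vector of $\mathbb R^N$: its law is $\frac1{N!}\sum_{\sigma\in\mathfrak S_N}\mathrm{Law}(\lambda_{\sigma(1)},\dots,\lambda_{\sigma(N)})$, where $\lambda_1\ge\dots\ge\lambda_N$ are the ordered eigenvalues of $X$. Then the law of the exchangeable spectrum of $X$ has, with respect to the Lebesgue measure on $\mathbb R^N$, the density $$\phi_N(x_1,\dots,x_N)=\frac{1}{(2\pi)^{N/2}\prod_{k=1}^N k!}\ \prod_{1\le i<j\le N}(x_i-x_j)^2\ \prod_{k=1}^N e^{-x_k^2/2}.$$ In particular, every random vector $L$ on $(\Omega,\mathcal F,\mathbb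 P)$ with values in $\mathbb R^N$ that almost surely lists the eigenvalues of $X$ with multiplicity and whose law is invariant under all permutations of the coordinates has a law with density $\phi_N$. -/

import Mathlib

open MeasureTheory ProbabilityTheory

/-- The index set of the real coordinates of a Hermitian matrix: the diagonal positions, and two
copies (real and imaginary part) of the positions strictly above the diagonal. -/
abbrev HermitianIndex (N : ℕ) : Type :=
  Fin N ⊕ ({p : Fin N × Fin N // p.1 < p.2} ⊕ {p : Fin N × Fin N // p.1 < p.2})

/-- The family `(M i i)`, `(√2 Re (M i j))`, `(√2 Im (M i j))` with `i < j`. -/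
noncomputable def hermitianCoord {N : ℕ} (M : Matrix (Fin N) (Fin N) ℂ) : HermitianIndex N → ℝ
  | Sum.inl i => (M i i).re
  | Sum.inr (Sum.inl p) => Real.sqrt 2 * (M p.1.1 p.1.2).re
  | Sum.inr (Sum.inr p) => Real.sqrt 2 * (M p.1.1 p.1.2).im

/-- `X` is a random matrix of the Gaussian Unitary Ensemble: it is Hermitian and its real
coordinates `X i i`, `√2 Re (X i j)`, `√2 Im (X i j)` with `i < j` are independent standard
Gaussian random variables. -/
structure IsGUE {Ω : Type*} [MeasurableSpace Ω] {N : ℕ}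
    (X : Ω → Matrix (Fin N) (Fin N) ℂ) (μ : Measure Ω) : Prop where
  hermitian : ∀ ω, (X ω).IsHermitian
  measurable_entry : ∀ i j, Measurable (fun ω => X ω i j)
  indep : iIndepFun (fun (a : HermitianIndex N) (ω : Ω) => hermitianCoord (X ω) a) μ
  gaussian : ∀ a : HermitianIndex N,
    HasLaw (fun ω => hermitianCoord (X ω) a) (gaussianReal 0 1) μ

/-- The law of the exchangeable spectrum of a random Hermitian matrix: the law of the vector
obtained by listing the eigenvalues, with multiplicity, and relabelling them by an independent
uniform permutation. -/
noncomputable def exchangeableSpectrumLaw {Ω : Type*} [MeasurableSpace Ω] {N : ℕ}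
    (X : Ω → Matrix (Fin N) (Fin N) ℂ) (hX : ∀ ω, (X ω).IsHermitian) (μ : Measure Ω) :
    Measure (Fin N → ℝ) :=
  ((Nat.factorial N : ENNReal)⁻¹) •
    ∑ σ : Equiv.Perm (Fin N), μ.map (fun ω i => (hX ω).eigenvalues (σ i))

/-- `L` is a version of the spectrum of `X` viewed as an exchangeable random vector: almost surely
`L` lists the eigenvalues of `X` with multiplicity, and the law of `L` is invariant under every
permutation of the coordinates. -/
structure IsExchangeableSpectrum {Ω : Type*} [MeasurableSpace Ω] {N : ℕ}
    (X : Ω → Matrix (Fin N) (Fin N) ℂ) (L : Ω → Fin N → ℝ) (μ : Measure Ω) : Prop where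
  aemeasurable : AEMeasurable L μ
  lists_eigenvalues : ∀ᵐ ω ∂μ,
    (X ω).charpoly.roots = (Finset.univ : Finset (Fin N)).val.map (fun i => (L ω i : ℂ))
  exchangeable : ∀ σ : Equiv.Perm (Fin N), μ.map (fun ω i => L ω (σ i)) = μ.map L

/-- The function
`(2π)^(-N/2) (∏_{k=1}^N k!)⁻¹ ∏_{i<j} (x i - x j)² ∏_k exp (-(x k)² / 2)` on `ℝ^N`. -/
noncomputable def gueEigenvalueDensity (N : ℕ) (x : Fin N → ℝ) : ℝ :=
  (∏ k : Fin N, Real.exp (-(x k) ^ 2 / 2)) /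
      ((2 * Real.pi) ^ ((N : ℝ) / 2) * ∏ k ∈ Finset.Icc 1 N, (Nat.factorial k : ℝ)) *
    ∏ i : Fin N, ∏ j ∈ Finset.Ioi i, (x i - x j) ^ 2

/-! No change of variables to eigenvalues and eigenvectors is made; the two laws are compared
through moments. Permutation-invariant laws on `ℝ^N` with exponential moments coincide once they
agree on polynomials in the power sums `p_k = ∑ x_i^k` (`Measure.ext_of_psum_eq`).

On both sides these expectations satisfy the same loop equations `E[p_(m+1) f] = ∑_{k<m} E[p_k
p_(m-1-k) f] + E[D_m f]`, with `D_m` the derivation `p_k ↦ k p_(k+m-1)`. For the matrix, `p_k = tr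
M^k`, and they are Gaussian integration by parts applied to `∑ M_ij (M^m)_ji f`
(`satisfiesLoopEquations_of_matrix`). For the density, let `V` be the Vandermonde product and
integrate by parts along the vector field `∑ x_i^m ∂_i`. Its divergence gives `∑ m x_i^(m-1)`, and
the logarithmic derivative of `V^2` gives `2 ∑_{i<j} (x_i^m - x_j^m)/(x_i - x_j)`. Together they
make up `∑_{k<m} p_k p_(m-1-k)`, precisely because `V` enters squared
(`satisfiesLoopEquations_of_vandermonde`).

With `p_0 = N` and total mass one, the loop equations have at most one solution
(`SatisfiesLoopEquations.unique`). The normalizing constant comes from orthogonality of the Hermite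
polynomials (`integral_vandermondeProd_sq`). -/

/-! ### Loop equations and uniqueness of their solution -/

/-- The derivation of the ring of polynomials in formal power sums `P k` that models
`∑ i, x i ^ m * ∂ i`, namely `P k ↦ k * P (k + m - 1)`. -/
noncomputable def powerSumDerivation (m : ℕ) :
    Derivation ℂ (MvPolynomial ℕ ℂ) (MvPolynomial ℕ ℂ) :=
  MvPolynomial.mkDerivation ℂ fun k => (k : ℂ) • MvPolynomial.X (k + m - 1)

/-- The Schwinger-Dyson (loop) equations of the Gaussian Unitary Ensemble for a linear functional
on polynomials in formal power sums. -/
structure SatisfiesLoopEquations (N : ℕ) (L : MvPolynomial ℕ ℂ →ₗ[ℂ] ℂ) : Prop where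
  map_one : L 1 = 1
  zero_mul : ∀ f, L (MvPolynomial.X 0 * f) = N * L f
  succ_mul : ∀ m f, L (MvPolynomial.X (m + 1) * f) =
    L ((∑ k ∈ Finset.range m, MvPolynomial.X k * MvPolynomial.X (m - 1 - k)) * f) +
      L (powerSumDerivation m f)

/-- Each equation expresses the value at a nonconstant monomial through monomials of smaller weight,
so induction on the weight leaves only the value at 1. -/
theorem SatisfiesLoopEquations.unique {N : ℕ} {L₁ L₂ : MvPolynomial ℕ ℂ →ₗ[ℂ] ℂ}
    (h₁ : SatisfiesLoopEquations N L₁) (h₂ : SatisfiesLoopEquations N L₂) : L₁ = L₂ := by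
  classical
  -- The shift `k + 1` gives `X 0` positive weight, so that `zero_mul` also lowers the weight.
  -- Replacing `X (m + 1)` by `X k * X (m - 1 - k)` still lowers it by one.
  let w : (ℕ →₀ ℕ) →+ ℕ := Finsupp.weight fun k => k + 1
  have hw : ∀ k, w (Finsupp.single k 1) = k + 1 := fun k => by simp [w, Finsupp.weight_single]
  have key : ∀ n, ∀ s : ℕ →₀ ℕ, w s ≤ n →
      L₁ (MvPolynomial.monomial s 1) = L₂ (MvPolynomial.monomial s 1) := by
    intro n
    induction n using Nat.strong_induction_on with
    | _ n ih =>
    intro s hs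
    have ih' : ∀ s' : ℕ →₀ ℕ, w s' < n →
        L₁ (MvPolynomial.monomial s' 1) = L₂ (MvPolynomial.monomial s' 1) :=
      fun s' hs' => ih _ hs' s' le_rfl
    by_cases h0 : s = 0
    · subst h0
      change L₁ 1 = L₂ 1
      rw [h₁.map_one, h₂.map_one]
    obtain ⟨k, hk⟩ := Finsupp.ne_iff.1 h0
    have hks : Finsupp.single k 1 ≤ s := by
      rw [Finsupp.single_le_iff]; exact Nat.one_le_iff_ne_zero.2 hk
    obtain ⟨t, rfl⟩ := exists_add_of_le hks
    rw [map_add, hw] at hs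
    have hX : ∀ (j : ℕ) (u : ℕ →₀ ℕ) (c : ℂ),
        (MvPolynomial.monomial (Finsupp.single j 1 + u) c : MvPolynomial ℕ ℂ) =
        MvPolynomial.X j * MvPolynomial.monomial u c := fun j u c => by
      rw [MvPolynomial.X, MvPolynomial.monomial_mul, one_mul]
    rw [hX]
    cases k with
    | zero => rw [h₁.zero_mul, h₂.zero_mul, ih' t (by omega)]
    | succ m =>
      rw [h₁.succ_mul, h₂.succ_mul]
      congr 1
      · rw [Finset.sum_mul, map_sum, map_sum]
        refine Finset.sum_congr rfl fun j hj => ?_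
        rw [Finset.mem_range] at hj
        rw [mul_assoc, ← hX, ← hX]
        refine ih' _ ?_
        rw [map_add, map_add, hw, hw]
        omega
      · rw [powerSumDerivation, MvPolynomial.mkDerivation_monomial, one_smul, Finsupp.sum, map_sum,
          map_sum]
        refine Finset.sum_congr rfl fun j hj => ?_
        have hjt : Finsupp.single j 1 ≤ t := by
          rw [Finsupp.single_le_iff]
          exact Nat.one_le_iff_ne_zero.2 (Finsupp.mem_support_iff.1 hj)
        obtain ⟨u, rfl⟩ := exists_add_of_le hjt
        rw [map_add, hw] at hs
        rw [add_tsub_cancel_left]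
        generalize (((Finsupp.single j 1 + u : ℕ →₀ ℕ) j : ℕ) : ℂ) = e
        have : (MvPolynomial.monomial u e : MvPolynomial ℕ ℂ) •
            ((j : ℂ) • (MvPolynomial.X (j + m - 1) : MvPolynomial ℕ ℂ)) =
            ((j : ℂ) * e) • MvPolynomial.monomial (Finsupp.single (j + m - 1) 1 + u) 1 := by
          rw [hX, show (MvPolynomial.monomial u e : MvPolynomial ℕ ℂ) =
            e • MvPolynomial.monomial u 1 by simp [MvPolynomial.smul_monomial]]
          simp only [smul_eq_mul, Algebra.smul_def, map_mul]
          ring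
        rw [this, map_smul, map_smul, ih']
        rw [map_add, hw]
        omega
  refine MvPolynomial.linearMap_ext fun s => LinearMap.ext_ring ?_
  exact key _ s le_rfl

theorem Derivation.finset_sum_apply {S ι : Type*} [CommRing S] [Algebra ℂ S] (s : Finset ι)
    (D : ι → Derivation ℂ S S) (a : S) : (∑ i ∈ s, D i) a = ∑ i ∈ s, D i a := by
  classical
  induction s using Finset.induction_on with
  | empty => simp
  | insert b s hb ih => rw [Finset.sum_insert hb, Finset.sum_insert hb, Derivation.add_apply, ih]

/-- Two derivations are related by an algebra homomorphism if they are so on the variables. -/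
theorem derivation_algHom_eq_of_X {σ S : Type*} [CommRing S] [Algebra ℂ S]
    (φ : MvPolynomial σ ℂ →ₐ[ℂ] S) (d : Derivation ℂ (MvPolynomial σ ℂ) (MvPolynomial σ ℂ))
    (D : Derivation ℂ S S) (h : ∀ k, D (φ (MvPolynomial.X k)) = φ (d (MvPolynomial.X k)))
    (f : MvPolynomial σ ℂ) : D (φ f) = φ (d f) := by
  induction f using MvPolynomial.induction_on with
  | C a =>
    rw [MvPolynomial.derivation_C, ← MvPolynomial.algebraMap_eq, AlgHom.commutes,
      Derivation.map_algebraMap, map_zero]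
  | add p q hp hq => simp only [map_add, hp, hq]
  | mul_X p n hp => simp only [map_mul, Derivation.leibniz, map_add, hp, h, smul_eq_mul]

/-- Used in both models: a derivation with the right effect on power sums realizes
`powerSumDerivation m` on every polynomial in them. -/
theorem powerSumDerivation_algHom {S : Type*} [CommRing S] [Algebra ℂ S] (φ : MvPolynomial ℕ ℂ →ₐ[ℂ] S)
    (m : ℕ) (D : Derivation ℂ S S)
    (h : ∀ k, D (φ (MvPolynomial.X k)) = (k : S) * φ (MvPolynomial.X (k + m - 1)))
    (f : MvPolynomial ℕ ℂ) : D (φ f) = φ (powerSumDerivation m f) := by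
  refine derivation_algHom_eq_of_X φ _ D (fun k => ?_) f
  rw [h, powerSumDerivation, MvPolynomial.mkDerivation_X, map_smul, Algebra.smul_def, map_natCast]

/-! ### Loop equations for traces of powers of a matrix -/

section MatrixModel

variable {S : Type*} [CommRing S] [Algebra ℂ S] {N : ℕ}

theorem Derivation.apply_mul_apply (d : Derivation ℂ S S) (A B : Matrix (Fin N) (Fin N) S)
    (i j : Fin N) : d ((A * B) i j) = (A.map d * B) i j + (A * B.map d) i j := by
  simp only [Matrix.mul_apply, map_sum, Derivation.leibniz, smul_eq_mul, Matrix.map_apply,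
    ← Finset.sum_add_distrib]
  refine Finset.sum_congr rfl fun k _ => ?_
  ring

theorem Derivation.map_matrix_mul (d : Derivation ℂ S S) (A B : Matrix (Fin N) (Fin N) S) :
    (A * B).map d = A.map d * B + A * B.map d := by
  ext i j
  simp [Derivation.apply_mul_apply]

theorem Derivation.map_matrix_one (d : Derivation ℂ S S) :
    (1 : Matrix (Fin N) (Fin N) S).map d = 0 := by
  ext i j
  rw [Matrix.map_apply, Matrix.one_apply]
  split_ifs <;> simp

theorem Derivation.map_matrix_pow (d : Derivation ℂ S S) (A : Matrix (Fin N) (Fin N) S) (m : ℕ) :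
    (A ^ m).map d = ∑ k ∈ Finset.range m, A ^ k * A.map d * A ^ (m - 1 - k) := by
  induction m with
  | zero => simp [Derivation.map_matrix_one]
  | succ m ih =>
    rw [pow_succ, Derivation.map_matrix_mul, ih, Finset.sum_range_succ, Finset.sum_mul]
    congr 1
    · refine Finset.sum_congr rfl fun k hk => ?_
      rw [Finset.mem_range] at hk
      rw [Matrix.mul_assoc, ← pow_succ]
      congr 2
      omega
    · simp

/-- By cyclicity of the trace, the `m` terms of the Leibniz expansion are equal. -/
theorem Derivation.trace_pow (d : Derivation ℂ S S) (A : Matrix (Fin N) (Fin N) S) (m : ℕ) :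
    d (A ^ m).trace = m * (A.map d * A ^ (m - 1)).trace := by
  have h : d (A ^ m).trace = ((A ^ m).map d).trace := by simp [Matrix.trace, map_sum]
  rw [h, Derivation.map_matrix_pow, Matrix.trace_sum, Finset.sum_congr rfl (g := fun _ =>
    (A.map d * A ^ (m - 1)).trace)]
  · simp
  · intro k hk
    rw [Finset.mem_range] at hk
    rw [Matrix.mul_assoc, Matrix.trace_mul_comm, Matrix.mul_assoc, ← pow_add]
    congr 3
    omega

/-- A functional on a ring containing a generic matrix `M` that obeys Gaussian integration by
parts satisfies the loop equations on traces of powers of `M`. -/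
theorem satisfiesLoopEquations_of_matrix (M : Matrix (Fin N) (Fin N) S)
    (d : Fin N → Fin N → Derivation ℂ S S)
    (hd : ∀ i j, M.map (d i j) = Matrix.single j i 1) (ℓ : S →ₗ[ℂ] ℂ) (h1 : ℓ 1 = 1)
    (hℓ : ∀ i j f, ℓ (M i j * f) = ℓ (d i j f)) :
    SatisfiesLoopEquations N
      (ℓ ∘ₗ (MvPolynomial.aeval (R := ℂ) fun k => (M ^ k).trace).toLinearMap) := by
  set ψ : MvPolynomial ℕ ℂ →ₐ[ℂ] S := MvPolynomial.aeval (R := ℂ) fun k => (M ^ k).trace with hψ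
  have hX : ∀ k, ψ (MvPolynomial.X k) = (M ^ k).trace := fun k => by rw [hψ, MvPolynomial.aeval_X]
  refine ⟨?_, fun f => ?_, fun m f => ?_⟩
  · simpa using h1
  · simp only [LinearMap.comp_apply, AlgHom.toLinearMap_apply, map_mul, hX, pow_zero,
      Matrix.trace_one, Fintype.card_fin]
    rw [← nsmul_eq_mul, map_nsmul, nsmul_eq_mul]
  · simp only [LinearMap.comp_apply, AlgHom.toLinearMap_apply, map_mul, hX, map_sum]
    -- This derivation sends `M` to `M ^ m`, hence the trace of `M ^ k` to `k` times that of `M ^ (k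
    -- + m - 1)`.
    have hD := powerSumDerivation_algHom ψ m (∑ i, ∑ j, (M ^ m) j i • d i j) (by
      intro k
      rw [hX, hX]
      simp only [Derivation.finset_sum_apply, Derivation.smul_apply, smul_eq_mul]
      simp only [Derivation.trace_pow, hd]
      have : ∀ i j, (M ^ m) j i * ((k : S) * (Matrix.single j i (1 : S) * M ^ (k - 1)).trace) =
          k * ((M ^ m) j i * (M ^ (k - 1)) i j) := fun i j => by
        rw [Matrix.trace_mul_comm, Matrix.trace_mul_single]
        simp
        ring
      simp only [this, ← Finset.mul_sum]
      -- For `k = 0` both sides carry the factor 0, so the truncated subtraction does no harm.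
      rcases Nat.eq_zero_or_pos k with rfl | hk
      · simp
      congr 1
      rw [show k + m - 1 = (k - 1) + m by omega, pow_add, Matrix.trace]
      refine Finset.sum_congr rfl fun i _ => ?_
      rw [Matrix.diag_apply, Matrix.mul_apply]
      exact Finset.sum_congr rfl fun j _ => mul_comm _ _)
    rw [← hD]
    have e1 : (M ^ (m + 1)).trace * ψ f = ∑ i, ∑ j, M i j * ((M ^ m) j i * ψ f) := by
      rw [pow_succ', Matrix.trace, Finset.sum_mul]
      refine Finset.sum_congr rfl fun i _ => ?_
      rw [Matrix.diag_apply, Matrix.mul_apply, Finset.sum_mul]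
      exact Finset.sum_congr rfl fun j _ => mul_assoc _ _ _
    -- The divergence term: inserting the matrix unit at `(j, i)` splits the trace into a product of
    -- two traces.
    have e2 : ∑ i, ∑ j, d i j ((M ^ m) j i) =
        ∑ k ∈ Finset.range m, (M ^ k).trace * (M ^ (m - 1 - k)).trace := by
      have : ∀ i j, d i j ((M ^ m) j i) =
          ∑ k ∈ Finset.range m, (M ^ k) j j * (M ^ (m - 1 - k)) i i := fun i j => by
        rw [← Matrix.map_apply (f := d i j), Derivation.map_matrix_pow, hd, Matrix.sum_apply]
        refine Finset.sum_congr rfl fun k _ => ?_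
        rw [Matrix.mul_apply, Finset.sum_eq_single i]
        · simp
        · intro b _ hb
          simp [Matrix.mul_single_apply_of_ne _ _ _ _ _ hb]
        · simp
      simp only [this]
      rw [Finset.sum_congr rfl fun i _ => Finset.sum_comm, Finset.sum_comm]
      refine Finset.sum_congr rfl fun k _ => ?_
      rw [Finset.sum_comm, Matrix.trace, Matrix.trace, Finset.sum_mul_sum]
      rfl
    rw [e1, ← map_add, ← e2]
    simp only [map_sum, hℓ, Derivation.leibniz, smul_eq_mul, map_add, Derivation.finset_sum_apply,
      Derivation.smul_apply, Finset.sum_mul, Finset.sum_add_distrib]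
    rw [add_comm]
    simp only [mul_comm]

end MatrixModel

/-! ### Loop equations for points weighted by the squared Vandermonde product -/

theorem Finset.sum_sum_eq_diag_add_two_mul {N : ℕ} {R : Type*} [CommRing R] (g : Fin N → Fin N → R)
    (hg : ∀ i j, g i j = g j i) :
    ∑ i, ∑ j, g i j = ∑ i, g i i + 2 * ∑ i, ∑ j ∈ Finset.Ioi i, g i j := by
  have h : ∀ i, ∑ j, g i j = g i i + ∑ j ∈ Finset.Ioi i, g i j + ∑ j ∈ Finset.Iio i, g i j := by
    intro i
    have : (Finset.univ : Finset (Fin N)) = insert i (Finset.Ioi i ∪ Finset.Iio i) := by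
      ext j
      simp only [Finset.mem_univ, Finset.mem_insert, Finset.mem_union, Finset.mem_Ioi,
        Finset.mem_Iio, true_iff]
      rcases lt_trichotomy i j with h | h | h
      · exact Or.inr (Or.inl h)
      · exact Or.inl h.symm
      · exact Or.inr (Or.inr h)
    rw [this, Finset.sum_insert (by simp), Finset.sum_union, add_assoc]
    rw [Finset.disjoint_left]
    intro j hj hj'
    rw [Finset.mem_Ioi] at hj
    rw [Finset.mem_Iio] at hj'
    exact lt_asymm hj hj'
  have h2 : ∑ i, ∑ j ∈ Finset.Iio i, g i j = ∑ i, ∑ j ∈ Finset.Ioi i, g i j := by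
    rw [Finset.sum_comm' (s' := fun j => Finset.Ioi j) (t' := Finset.univ) (by simp)]
    exact Finset.sum_congr rfl fun i _ => Finset.sum_congr rfl fun j _ => hg _ _
  simp only [h, Finset.sum_add_distrib, h2]
  ring

section EigenvalueModel

variable {S : Type*} [CommRing S] [Algebra ℂ S] {N : ℕ}

/-- Logarithmic differentiation without division: `h i` stands for `D (f i) / f i`. -/
theorem Derivation.prod_of_dvd {ι : Type*} (D : Derivation ℂ S S)
    (s : Finset ι) (f h : ι → S) (hf : ∀ i ∈ s, D (f i) = f i * h i) :
    D (∏ i ∈ s, f i) = (∏ i ∈ s, f i) * ∑ i ∈ s, h i := by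
  classical
  induction s using Finset.induction_on with
  | empty => simp
  | insert a s ha ih =>
    rw [Finset.prod_insert ha, Finset.sum_insert ha, Derivation.leibniz,
      ih fun i hi => hf i (Finset.mem_insert_of_mem hi), hf a (Finset.mem_insert_self _ _)]
    simp only [smul_eq_mul]
    ring

/-- A functional that obeys Gaussian integration by parts, tilted by the squared Vandermonde
product and normalized, satisfies the loop equations on power sums. -/
theorem satisfiesLoopEquations_of_vandermonde (x : Fin N → S) (d : Fin N → Derivation ℂ S S)
    (hd : ∀ i j, d i (x j) = if i = j then 1 else 0) (V : S)
    (hV : V = ∏ i : Fin N, ∏ j ∈ Finset.Ioi i, (x i - x j)) (ℓ : S →ₗ[ℂ] ℂ)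
    (hℓ : ∀ i f, ℓ (x i * f) = ℓ (d i f)) (c : ℂ) (hc : c * ℓ (V ^ 2) = 1) :
    SatisfiesLoopEquations N
      (c • (ℓ ∘ₗ LinearMap.mulLeft ℂ (V ^ 2) ∘ₗ
        (MvPolynomial.aeval (R := ℂ) fun k => ∑ i, x i ^ k).toLinearMap)) := by
  set φ : MvPolynomial ℕ ℂ →ₐ[ℂ] S := MvPolynomial.aeval (R := ℂ) fun k => ∑ i, x i ^ k with hφ
  have hX : ∀ k, φ (MvPolynomial.X k) = ∑ i, x i ^ k := fun k => by
    rw [hφ, MvPolynomial.aeval_X]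
  refine ⟨?_, fun f => ?_, fun m f => ?_⟩
  · simpa using hc
  · simp only [LinearMap.smul_apply, LinearMap.comp_apply, AlgHom.toLinearMap_apply, map_mul, hX,
      LinearMap.mulLeft_apply, smul_eq_mul, pow_zero, Finset.sum_const, Finset.card_univ,
      Fintype.card_fin, nsmul_one]
    rw [mul_left_comm, ← nsmul_eq_mul, map_nsmul, nsmul_eq_mul, mul_left_comm]
  · simp only [LinearMap.smul_apply, LinearMap.comp_apply, AlgHom.toLinearMap_apply, map_mul, hX,
      LinearMap.mulLeft_apply, smul_eq_mul, map_sum]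
    rw [← mul_add]
    congr 1
    obtain ⟨D, hDdef⟩ : ∃ D : Derivation ℂ S S, ∀ g, D g = ∑ i, x i ^ m * d i g :=
      ⟨∑ i, x i ^ m • d i, fun g => by
        simp only [Derivation.finset_sum_apply, Derivation.smul_apply, smul_eq_mul]⟩
    have hDX : ∀ i, D (x i) = x i ^ m := fun i => by simp [hDdef, hd]
    have hD := powerSumDerivation_algHom φ m D (by
      intro k
      rw [hX, hX, map_sum, Finset.mul_sum]
      refine Finset.sum_congr rfl fun i _ => ?_
      rw [Derivation.leibniz_pow, hDX, nsmul_eq_mul, smul_eq_mul]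
      rcases Nat.eq_zero_or_pos k with rfl | hk
      · simp
      rw [← pow_add, show k + m - 1 = k - 1 + m by omega])
    rw [← hD]
    -- The divided difference `(x_i^m - x_j^m) / (x_i - x_j)`, written as a polynomial so that it
    -- also makes sense on the diagonal, where it is `m x_i^(m-1)`.
    let h : Fin N → Fin N → S := fun i j => ∑ k ∈ Finset.range m, x i ^ k * x j ^ (m - 1 - k)
    have hsymm : ∀ i j, h i j = h j i := fun i j => by
      simp only [h]
      rw [← Finset.sum_range_reflect]
      refine Finset.sum_congr rfl fun k hk => ?_
      rw [Finset.mem_range] at hk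
      rw [mul_comm]
      congr 2
      omega
    have hDV : D V = V * ∑ i, ∑ j ∈ Finset.Ioi i, h i j := by
      rw [hV]
      refine Derivation.prod_of_dvd D _ _ _ fun i _ => Derivation.prod_of_dvd D _ _ _ fun j _ => ?_
      rw [map_sub, hDX, hDX, mul_comm]
      exact (geom_sum₂_mul _ _ _).symm
    have e1 : V ^ 2 * ((∑ i, x i ^ (m + 1)) * φ f) = ∑ i, x i * (x i ^ m * (V ^ 2 * φ f)) := by
      rw [Finset.sum_mul, Finset.mul_sum]
      refine Finset.sum_congr rfl fun i _ => ?_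
      ring
    have e2 : ∀ g, ∑ i, d i (x i ^ m * g) = D g + (∑ i, h i i) * g := fun g => by
      rw [hDdef, Finset.sum_mul, ← Finset.sum_add_distrib]
      refine Finset.sum_congr rfl fun i _ => ?_
      rw [Derivation.leibniz, Derivation.leibniz_pow, hd, if_pos rfl, smul_eq_mul, smul_eq_mul,
        nsmul_eq_mul, smul_eq_mul, mul_one, mul_comm g]
      congr 2
      simp only [h]
      rw [Finset.sum_congr rfl (g := fun _ => x i ^ (m - 1))]
      · simp
      · intro k hk
        rw [Finset.mem_range] at hk
        rw [← pow_add]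
        congr 1
        omega
    have e3 : ∑ k ∈ Finset.range m, (∑ i, x i ^ k) * ∑ i, x i ^ (m - 1 - k) =
        ∑ i, ∑ j, h i j := by
      simp only [h]
      rw [Finset.sum_congr rfl fun i _ => Finset.sum_comm, Finset.sum_comm]
      refine Finset.sum_congr rfl fun k _ => ?_
      rw [Finset.sum_mul_sum]
    rw [e1, map_sum, ← map_add]
    simp only [hℓ]
    -- The diagonal of the symmetric double sum is the divergence, and its off-diagonal part, twice
    -- the sum over `i < j`, is `D (V ^ 2) / V ^ 2`.
    rw [← map_sum, e2, e3, Finset.sum_sum_eq_diag_add_two_mul h hsymm, Derivation.leibniz,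
      Derivation.leibniz_pow, hDV]
    congr 1
    simp only [smul_eq_mul, nsmul_eq_mul]
    push_cast
    ring

end EigenvalueModel

/-! ### Gaussian moments and integration by parts -/

theorem integrable_pow_gaussianReal (n : ℕ) :
    Integrable (fun x : ℝ => x ^ n) (gaussianReal 0 1) := by
  have h := integrable_pow_of_mem_interior_integrableExpSet (X := id) (μ := gaussianReal 0 1)
    (by rw [integrableExpSet_id_gaussianReal]; simp) n
  simpa using h

theorem integrable_gaussianPDFReal_mul_iff {f : ℝ → ℝ} :
    Integrable f (gaussianReal 0 1) ↔ Integrable (fun x => gaussianPDFReal 0 1 x * f x) := by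
  rw [gaussianReal_of_var_ne_zero 0 one_ne_zero,
    integrable_withDensity_iff_integrable_smul' (measurable_gaussianPDF 0 1)
      (ae_of_all _ fun x => gaussianPDF_lt_top)]
  simp only [toReal_gaussianPDF, smul_eq_mul]

/-- The density `φ` satisfies `φ' = -x φ`, and the derivative of `φ x^n` has integral zero. At `n =
0` the truncated exponent is multiplied by 0. -/
theorem integral_pow_succ_gaussianReal (n : ℕ) :
    ∫ x, x ^ (n + 1) ∂(gaussianReal 0 1) = n * ∫ x, x ^ (n - 1) ∂(gaussianReal 0 1) := by
  have hpdf : ∀ x, HasDerivAt (gaussianPDFReal 0 1) (-x * gaussianPDFReal 0 1 x) x := by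
    intro x
    have h : HasDerivAt (fun y : ℝ => -(y - 0) ^ 2 / (2 * ((1 : NNReal) : ℝ))) (-x) x := by
      refine ((((hasDerivAt_id x).sub_const 0).pow 2).neg.div_const _).congr_deriv ?_
      simp only [id]
      norm_num
      ring
    refine (h.exp.const_mul (√(2 * Real.pi * ((1 : NNReal) : ℝ)))⁻¹).congr_deriv ?_
    simp only [gaussianPDFReal]
    ring
  have hd : ∀ x : ℝ, HasDerivAt (fun x => gaussianPDFReal 0 1 x * x ^ n)
      (n * (gaussianPDFReal 0 1 x * x ^ (n - 1)) - gaussianPDFReal 0 1 x * x ^ (n + 1)) x := by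
    intro x
    refine ((hpdf x).mul (hasDerivAt_pow n x)).congr_deriv ?_
    ring
  have hi : ∀ k, Integrable (fun x => gaussianPDFReal 0 1 x * x ^ k) := fun k =>
    integrable_gaussianPDFReal_mul_iff.1 (integrable_pow_gaussianReal k)
  have h0 := integral_eq_zero_of_hasDerivAt_of_integrable hd
    (((hi (n - 1)).const_mul _).sub (hi (n + 1))) (hi n)
  rw [integral_sub ((hi (n - 1)).const_mul _) (hi (n + 1)), integral_const_mul, sub_eq_zero] at h0
  simp only [integral_gaussianReal_eq_integral_smul one_ne_zero, smul_eq_mul]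
  exact h0.symm

section Multivariate

variable {σ : Type*} [Fintype σ]

/-- The standard Gaussian measure on `ℝ^σ`. -/
noncomputable abbrev stdGaussianPi (σ : Type*) [Fintype σ] : Measure (σ → ℝ) :=
  Measure.pi fun _ => gaussianReal 0 1

theorem eval_ofReal_monomial (s : σ →₀ ℕ) (c : ℂ) (x : σ → ℝ) :
    MvPolynomial.eval (fun i => (x i : ℂ)) (MvPolynomial.monomial s c) =
      c * ∏ i, ((x i : ℂ) ^ s i) := by
  rw [MvPolynomial.eval_monomial, Finsupp.prod_fintype _ _ fun i => pow_zero _]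

theorem integrable_eval_stdGaussianPi (f : MvPolynomial σ ℂ) :
    Integrable (fun x : σ → ℝ => MvPolynomial.eval (fun i => (x i : ℂ)) f) (stdGaussianPi σ) := by
  induction f using MvPolynomial.induction_on' with
  | monomial s c =>
    simp only [eval_ofReal_monomial]
    refine Integrable.const_mul ?_ c
    refine Integrable.fintype_prod (f := fun i (v : ℝ) => (v : ℂ) ^ s i) fun i => ?_
    simpa using (integrable_pow_gaussianReal (s i)).ofReal (𝕜 := ℂ)
  | add p q hp hq =>
    simp only [map_add]
    exact hp.add hq

/-- Expectation of a polynomial in independent standard Gaussian variables. -/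
noncomputable def gaussianExpectation (σ : Type*) [Fintype σ] : MvPolynomial σ ℂ →ₗ[ℂ] ℂ where
  toFun f := ∫ x : σ → ℝ, MvPolynomial.eval (fun i => (x i : ℂ)) f ∂(stdGaussianPi σ)
  map_add' f g := by
    simp only [map_add]
    exact integral_add (integrable_eval_stdGaussianPi f) (integrable_eval_stdGaussianPi g)
  map_smul' c f := by
    simp only [MvPolynomial.smul_eval, RingHom.id_apply, smul_eq_mul]
    exact integral_const_mul _ _

theorem gaussianExpectation_apply (f : MvPolynomial σ ℂ) : gaussianExpectation σ f =
    ∫ x : σ → ℝ, MvPolynomial.eval (fun i => (x i : ℂ)) f ∂(stdGaussianPi σ) := rfl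

theorem gaussianExpectation_one : gaussianExpectation σ 1 = 1 := by
  simp [gaussianExpectation_apply]

theorem gaussianExpectation_monomial (s : σ →₀ ℕ) (c : ℂ) :
    gaussianExpectation σ (MvPolynomial.monomial s c) =
      c * ∏ i, ((∫ x, x ^ s i ∂(gaussianReal 0 1) : ℝ) : ℂ) := by
  simp only [gaussianExpectation_apply, eval_ofReal_monomial]
  rw [integral_const_mul, integral_fintype_prod_eq_prod (f := fun i (v : ℝ) => (v : ℂ) ^ s i)]
  congr 1
  refine Finset.prod_congr rfl fun i _ => ?_
  rw [← integral_complex_ofReal]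
  simp

/-- Gaussian integration by parts. -/
theorem gaussianExpectation_X_mul (i : σ) (f : MvPolynomial σ ℂ) :
    gaussianExpectation σ (MvPolynomial.X i * f) =
      gaussianExpectation σ (MvPolynomial.pderiv i f) := by
  classical
  induction f using MvPolynomial.induction_on' with
  | add p q hp hq => rw [mul_add, map_add, hp, hq, map_add, map_add]
  | monomial s c =>
    rw [MvPolynomial.X, MvPolynomial.monomial_mul, one_mul, MvPolynomial.pderiv_monomial,
      gaussianExpectation_monomial, gaussianExpectation_monomial,
      ← Finset.mul_prod_erase _ _ (Finset.mem_univ i),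
      ← Finset.mul_prod_erase Finset.univ (fun j => ((∫ x, x ^ (s - Finsupp.single i 1 : σ →₀ ℕ) j
        ∂(gaussianReal 0 1) : ℝ) : ℂ)) (Finset.mem_univ i)]
    have h1 : (Finsupp.single i 1 + s : σ →₀ ℕ) i = s i + 1 := by simp [add_comm]
    have h2 : (s - Finsupp.single i 1 : σ →₀ ℕ) i = s i - 1 := by simp
    rw [h1, h2, integral_pow_succ_gaussianReal, mul_assoc]
    congr 1
    push_cast
    rw [mul_assoc]
    congr 2
    refine Finset.prod_congr rfl fun j hj => ?_
    have hj' : i ≠ j := (Finset.ne_of_mem_erase hj).symm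
    simp [Finsupp.single_eq_of_ne' hj']

end Multivariate

/-! ### Laws determined by moments and by power sums -/

/-- Both moment generating functions are analytic on the whole line, with Taylor coefficients at 0
given by the moments. The identity theorem makes them equal on the line, and analytic continuation
extends this to complex arguments. -/
theorem complexMGF_eq_of_moments_eq {α β : Type*} [MeasurableSpace α] [MeasurableSpace β]
    {μ : Measure α} {ν : Measure β} [IsProbabilityMeasure μ] {X : α → ℝ} {Y : β → ℝ}
    (hX : ∀ t : ℝ, Integrable (fun a => Real.exp (t * X a)) μ)
    (hY : ∀ t : ℝ, Integrable (fun b => Real.exp (t * Y b)) ν)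
    (h : ∀ n : ℕ, ∫ a, X a ^ n ∂μ = ∫ b, Y b ^ n ∂ν) : complexMGF X μ = complexMGF Y ν := by
  have hX' : interior (integrableExpSet X μ) = Set.univ := by
    rw [show integrableExpSet X μ = Set.univ from Set.eq_univ_of_forall hX, interior_univ]
  have hY' : interior (integrableExpSet Y ν) = Set.univ := by
    rw [show integrableExpSet Y ν = Set.univ from Set.eq_univ_of_forall hY, interior_univ]
  have h1 := hasFPowerSeriesAt_mgf (X := X) (μ := μ) (v := 0) (by rw [hX']; trivial)
  have h2 := hasFPowerSeriesAt_mgf (X := Y) (μ := ν) (v := 0) (by rw [hY']; trivial)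
  simp only [zero_mul, Real.exp_zero, mul_one, h] at h1 h2
  have hev : mgf X μ =ᶠ[nhds 0] mgf Y ν := by
    have e1 := h1.eventually_hasSum_sub
    have e2 := h2.eventually_hasSum_sub
    filter_upwards [e1, e2] with t ht1 ht2 using ht1.unique ht2
  have hmgf : mgf X μ = mgf Y ν := by
    refine AnalyticOnNhd.eq_of_eventuallyEq (𝕜 := ℝ) (z₀ := (0 : ℝ)) ?_ ?_ hev
    · rw [← hX']; exact analyticOnNhd_mgf
    · rw [← hY']; exact analyticOnNhd_mgf
  funext z
  exact eqOn_complexMGF_of_mgf hmgf (by rw [hX']; trivial)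

section Multivariate

variable {σ : Type*} [Fintype σ]

/-- Two laws on `ℝ^σ` with all exponential moments and with the same moments are equal. -/
theorem Measure.ext_of_eval_eq {μ ν : Measure (σ → ℝ)} [IsProbabilityMeasure μ]
    [IsProbabilityMeasure ν]
    (hμ : ∀ u : σ → ℝ, Integrable (fun x : σ → ℝ => Real.exp (∑ i, u i * x i)) μ)
    (hν : ∀ u : σ → ℝ, Integrable (fun x : σ → ℝ => Real.exp (∑ i, u i * x i)) ν)
    (h : ∀ f : MvPolynomial σ ℂ, ∫ x : σ → ℝ, MvPolynomial.eval (fun i => (x i : ℂ)) f ∂μ =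
      ∫ x : σ → ℝ, MvPolynomial.eval (fun i => (x i : ℂ)) f ∂ν) : μ = ν := by
  classical
  refine Measure.ext_of_charFunDual (funext fun L => ?_)
  have hL : ∀ x, L x = ∑ i, L (Pi.single i 1) * x i := fun x => by
    conv_lhs => rw [← Finset.univ_sum_single x, map_sum]
    refine Finset.sum_congr rfl fun i _ => ?_
    rw [mul_comm, ← smul_eq_mul, ← map_smul, ← Pi.single_smul, smul_eq_mul, mul_one]
  have hexp : ∀ {ρ : Measure (σ → ℝ)},
      (∀ u : σ → ℝ, Integrable (fun x : σ → ℝ => Real.exp (∑ i, u i * x i)) ρ) →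
      ∀ t : ℝ, Integrable (fun x => Real.exp (t * L x)) ρ := fun hρ t => by
    refine (hρ fun i => t * L (Pi.single i 1)).congr (ae_of_all _ fun x => ?_)
    simp only [hL x, Finset.mul_sum, mul_assoc]
  -- Reduction to one dimension: the moments of a linear form are expectations of polynomials, and
  -- its complex moment generating function at `I` is the characteristic function.
  have key := complexMGF_eq_of_moments_eq (hexp hμ) (hexp hν) fun n => by
    have := h ((∑ i, MvPolynomial.C (L (Pi.single i 1) : ℂ) * MvPolynomial.X i) ^ n)
    simp only [map_pow, map_sum, map_mul, MvPolynomial.eval_C, MvPolynomial.eval_X] at this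
    simp only [← Complex.ofReal_mul, ← Complex.ofReal_sum, ← hL, ← Complex.ofReal_pow] at this
    rw [integral_complex_ofReal, integral_complex_ofReal] at this
    exact_mod_cast this
  have := congrFun key Complex.I
  simp only [complexMGF] at this
  rw [charFunDual_apply, charFunDual_apply]
  simpa only [mul_comm] using this

/-- Power sums generate the symmetric polynomials in characteristic zero. -/
theorem MvPolynomial.IsSymmetric.mem_range_aeval_psum {f : MvPolynomial σ ℂ}
    (hf : f.IsSymmetric) :
    f ∈ (MvPolynomial.aeval (R := ℂ) fun k => MvPolynomial.psum σ ℂ k).range := by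
  set R := (MvPolynomial.aeval (R := ℂ) fun k => MvPolynomial.psum σ ℂ k).range
  have hp : ∀ k, MvPolynomial.psum σ ℂ k ∈ R := fun k =>
    ⟨MvPolynomial.X k, MvPolynomial.aeval_X _ _⟩
  have he : ∀ k, MvPolynomial.esymm σ ℂ k ∈ R := by
    intro k
    induction k using Nat.strong_induction_on with
    | _ k ih =>
    rcases Nat.eq_zero_or_pos k with rfl | hk
    · rw [MvPolynomial.esymm_zero]; exact one_mem R
    have hmem : (k : MvPolynomial σ ℂ) * MvPolynomial.esymm σ ℂ k ∈ R := by
      -- Newton's identity writes `k e_k` through lower `e_j` and power sums; characteristic zero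
      -- then allows division by `k`.
      rw [MvPolynomial.mul_esymm_eq_sum]
      refine mul_mem (pow_mem (neg_mem (one_mem R)) _) (sum_mem fun a ha => ?_)
      exact mul_mem (mul_mem (pow_mem (neg_mem (one_mem R)) _) (ih _ (Finset.mem_filter.1 ha).2))
        (hp _)
    have hk' : (k : ℂ) ≠ 0 := by exact_mod_cast hk.ne'
    have := R.smul_mem hmem ((k : ℂ)⁻¹)
    rwa [← nsmul_eq_mul, ← Nat.cast_smul_eq_nsmul ℂ, smul_smul, inv_mul_cancel₀ hk',
      one_smul] at this
  obtain ⟨g, hg⟩ := MvPolynomial.esymmAlgHom_surjective ℂ (le_refl (Fintype.card σ)) ⟨f, hf⟩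
  have hfg : f = MvPolynomial.aeval
      (fun i : Fin (Fintype.card σ) => MvPolynomial.esymm σ ℂ (i + 1)) g := by
    rw [← MvPolynomial.esymmAlgHom_apply, hg]
  rw [hfg]
  induction g using MvPolynomial.induction_on generalizing f with
  | C a => rw [MvPolynomial.aeval_C]; exact R.algebraMap_mem a
  | add p q hp hq =>
    rw [map_add]
    exact add_mem (hp (MvPolynomial.esymmAlgHom σ ℂ _ p).2 rfl
      (MvPolynomial.esymmAlgHom_apply _)) (hq (MvPolynomial.esymmAlgHom σ ℂ _ q).2 rfl
      (MvPolynomial.esymmAlgHom_apply _))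
  | mul_X p i hp =>
    rw [map_mul, MvPolynomial.aeval_X]
    exact mul_mem (hp (MvPolynomial.esymmAlgHom σ ℂ _ p).2 rfl
      (MvPolynomial.esymmAlgHom_apply _)) (he _)

theorem MvPolynomial.isSymmetric_sum_rename [DecidableEq σ] (f : MvPolynomial σ ℂ) :
    (∑ τ : Equiv.Perm σ, MvPolynomial.rename τ f).IsSymmetric := by
  intro e
  rw [map_sum]
  simp only [MvPolynomial.rename_rename]
  exact Fintype.sum_equiv (Equiv.mulLeft e) _ _ fun τ => rfl

/-- Two permutation-invariant laws on `ℝ^σ` with all exponential moments are equal if they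
give the same expectation to all polynomials in the power sums. -/
theorem Measure.ext_of_psum_eq [DecidableEq σ] {μ ν : Measure (σ → ℝ)} [IsProbabilityMeasure μ]
    [IsProbabilityMeasure ν]
    (hμ : ∀ u : σ → ℝ, Integrable (fun x : σ → ℝ => Real.exp (∑ i, u i * x i)) μ)
    (hν : ∀ u : σ → ℝ, Integrable (fun x : σ → ℝ => Real.exp (∑ i, u i * x i)) ν)
    (hμi : ∀ f : MvPolynomial σ ℂ,
      Integrable (fun x : σ → ℝ => MvPolynomial.eval (fun i => (x i : ℂ)) f) μ)
    (hνi : ∀ f : MvPolynomial σ ℂ,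
      Integrable (fun x : σ → ℝ => MvPolynomial.eval (fun i => (x i : ℂ)) f) ν)
    (hμs : ∀ τ : Equiv.Perm σ, μ.map (fun x i => x (τ i)) = μ)
    (hνs : ∀ τ : Equiv.Perm σ, ν.map (fun x i => x (τ i)) = ν)
    (h : ∀ f : MvPolynomial ℕ ℂ,
      ∫ x : σ → ℝ, MvPolynomial.aeval (fun k : ℕ => ∑ i, (x i : ℂ) ^ k) f ∂μ =
      ∫ x : σ → ℝ, MvPolynomial.aeval (fun k : ℕ => ∑ i, (x i : ℂ) ^ k) f ∂ν) : μ = ν := by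
  refine Measure.ext_of_eval_eq hμ hν fun f => ?_
  -- Under an invariant law the symmetrization of `f` integrates to `|S_σ|` times the integral of
  -- `f`, and it is a polynomial in power sums.
  obtain ⟨g, hg⟩ := (MvPolynomial.isSymmetric_sum_rename f).mem_range_aeval_psum
  have key : ∀ ρ : Measure (σ → ℝ), (∀ f : MvPolynomial σ ℂ,
        Integrable (fun x : σ → ℝ => MvPolynomial.eval (fun i => (x i : ℂ)) f) ρ) →
      (∀ τ : Equiv.Perm σ, ρ.map (fun x i => x (τ i)) = ρ) →
      (Fintype.card (Equiv.Perm σ) : ℂ) *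
        ∫ x : σ → ℝ, MvPolynomial.eval (fun i => (x i : ℂ)) f ∂ρ =
      ∫ x : σ → ℝ, MvPolynomial.aeval (fun k : ℕ => ∑ i, (x i : ℂ) ^ k) g ∂ρ := by
    intro ρ hρi hρs
    have e : ∀ x : σ → ℝ, MvPolynomial.aeval (fun k : ℕ => ∑ i, (x i : ℂ) ^ k) g =
        ∑ τ : Equiv.Perm σ, MvPolynomial.eval (fun i => (x (τ i) : ℂ)) f := by
      intro x
      have hx := congrArg (MvPolynomial.aeval (R := ℂ) fun i => (x i : ℂ)) hg
      have hcomp : (MvPolynomial.aeval (R := ℂ) fun i => (x i : ℂ)).comp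
          (MvPolynomial.aeval (R := ℂ) fun k => MvPolynomial.psum σ ℂ k) =
          MvPolynomial.aeval (fun k : ℕ => ∑ i, (x i : ℂ) ^ k) := by
        refine MvPolynomial.algHom_ext fun k => ?_
        simp [MvPolynomial.psum]
      rw [← hcomp, AlgHom.comp_apply]
      refine hx.trans ?_
      rw [map_sum]
      refine Finset.sum_congr rfl fun τ _ => ?_
      rw [MvPolynomial.aeval_rename]
      rfl
    simp only [e]
    have hm : ∀ τ : Equiv.Perm σ, Measurable fun (x : σ → ℝ) i => x (τ i) := fun τ => by fun_prop
    have hi : ∀ τ : Equiv.Perm σ, Integrable (fun x : σ → ℝ =>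
        MvPolynomial.eval (fun i => (x (τ i) : ℂ)) f) ρ := fun τ => by
      have := hρi f
      rw [← hρs τ] at this
      exact this.comp_measurable (hm τ)
    rw [integral_finsetSum _ fun τ _ => hi τ]
    have heq : ∀ τ : Equiv.Perm σ, ∫ x : σ → ℝ, MvPolynomial.eval (fun i => (x (τ i) : ℂ)) f ∂ρ =
        ∫ x : σ → ℝ, MvPolynomial.eval (fun i => (x i : ℂ)) f ∂ρ := fun τ => by
      have h1 := hρi f
      rw [← hρs τ] at h1
      have := integral_map (hm τ).aemeasurable h1.aestronglyMeasurable
      rw [hρs τ] at this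
      exact this.symm
    simp [heq]
  have hc : (Fintype.card (Equiv.Perm σ) : ℂ) ≠ 0 := by exact_mod_cast Fintype.card_ne_zero
  refine mul_left_cancel₀ hc ?_
  rw [key μ hμi hμs, key ν hνi hνs, h]

end Multivariate

/-! ### Measurability of the eigenvalues -/

/-- An antitone vector is determined by its monic polynomial, here evaluated at the integers. -/
theorem injective_prod_natCast_sub (m : ℕ) : Function.Injective
    (fun (x : {x : Fin m → ℝ // Antitone x}) (k : ℕ) => ∏ i, ((k : ℝ) - x.1 i)) := by
  intro x y hxy
  have hpoly : (∏ i, (Polynomial.X - Polynomial.C (x.1 i)) : Polynomial ℝ) =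
      ∏ i, (Polynomial.X - Polynomial.C (y.1 i)) := by
    refine Polynomial.eq_of_infinite_eval_eq _ _ ?_
    refine Set.Infinite.mono (s := Set.range fun k : ℕ => (k : ℝ)) ?_
      (Set.infinite_range_of_injective Nat.cast_injective)
    rintro _ ⟨k, rfl⟩
    have := congrFun hxy k
    simpa [Polynomial.eval_prod] using this
  have hroots : ∀ z : Fin m → ℝ,
      (∏ i, (Polynomial.X - Polynomial.C (z i)) : Polynomial ℝ).roots =
        (List.ofFn z : Multiset ℝ) := by
    intro z
    rw [← Fin.univ_val_map, ← Polynomial.roots_multiset_prod_X_sub_C (Multiset.map z _),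
      Multiset.map_map]
    rfl
  have hperm : (List.ofFn x.1).Perm (List.ofFn y.1) := by
    rw [← Multiset.coe_eq_coe, ← hroots, ← hroots, hpoly]
  exact Subtype.ext (List.ofFn_injective
    (hperm.eq_of_sortedGE x.2.sortedGE_ofFn y.2.sortedGE_ofFn))

/-- A continuous injection from a Polish space is a measurable embedding (Lusin–Souslin).
Measurability of the ordered spectrum can thus be tested on the numbers `det (k - X)`, which are
polynomial in the entries. -/
theorem measurableEmbedding_prod_natCast_sub (m : ℕ) : MeasurableEmbedding
    (fun (x : {x : Fin m → ℝ // Antitone x}) (k : ℕ) => ∏ i, ((k : ℝ) - x.1 i)) := by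
  have hclosed : IsClosed {x : Fin m → ℝ | Antitone x} := by
    simp only [Antitone, Set.ofPred_forall]
    refine isClosed_iInter fun i => isClosed_iInter fun j => isClosed_iInter fun _ => ?_
    exact isClosed_le (continuous_apply j) (continuous_apply i)
  have : PolishSpace {x : Fin m → ℝ // Antitone x} := hclosed.polishSpace
  exact Continuous.measurableEmbedding (continuous_pi fun k => continuous_finsetProd _ fun i _ =>
    continuous_const.sub ((continuous_apply i).comp continuous_subtype_val))
    (injective_prod_natCast_sub m)

section Eigenvalues

variable {Ω : Type*} [MeasurableSpace Ω] {N : ℕ}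

theorem measurable_matrix_det {ι : Type*} [Fintype ι] [DecidableEq ι] {A : Ω → Matrix ι ι ℂ}
    (hA : ∀ i j, Measurable fun ω => A ω i j) : Measurable fun ω => (A ω).det := by
  simp only [Matrix.det_apply]
  fun_prop

theorem Matrix.IsHermitian.prod_natCast_sub_eigenvalues₀ {A : Matrix (Fin N) (Fin N) ℂ}
    (hA : A.IsHermitian) (k : ℕ) : ∏ i, ((k : ℝ) - hA.eigenvalues₀ i) =
      ((Matrix.scalar (Fin N) (k : ℂ) - A).det).re := by
  have h : (Matrix.scalar (Fin N) (k : ℂ) - A).det = ∏ i, ((k : ℂ) - (hA.eigenvalues i : ℂ)) := by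
    rw [← Matrix.eval_charpoly, hA.charpoly_eq, Polynomial.eval_prod]
    simp
  rw [h]
  have h2 : ∏ i, ((k : ℂ) - (hA.eigenvalues i : ℂ)) =
      ((∏ i, ((k : ℝ) - hA.eigenvalues i) : ℝ) : ℂ) := by
    push_cast; rfl
  rw [h2, Complex.ofReal_re]
  unfold Matrix.IsHermitian.eigenvalues
  exact (Equiv.prod_comp _ fun i => (k : ℝ) - hA.eigenvalues₀ i).symm

theorem measurable_eigenvalues {X : Ω → Matrix (Fin N) (Fin N) ℂ}
    (hX : ∀ ω, (X ω).IsHermitian) (hm : ∀ i j, Measurable fun ω => X ω i j) :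
    Measurable fun ω => (hX ω).eigenvalues := by
  have h0 : Measurable fun ω => (⟨(hX ω).eigenvalues₀, (hX ω).eigenvalues₀_antitone⟩ :
      {x : Fin (Fintype.card (Fin N)) → ℝ // Antitone x}) := by
    rw [← (measurableEmbedding_prod_natCast_sub _).measurable_comp_iff]
    refine measurable_pi_lambda _ fun k => ?_
    simp only [Function.comp_apply, Matrix.IsHermitian.prod_natCast_sub_eigenvalues₀]
    refine Complex.measurable_re.comp (measurable_matrix_det fun i j => ?_)
    simp only [Matrix.sub_apply]
    exact measurable_const.sub (hm i j)
  have h1 : Measurable fun ω => (hX ω).eigenvalues₀ := measurable_subtype_coe.comp h0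
  refine measurable_pi_lambda _ fun i => ?_
  unfold Matrix.IsHermitian.eigenvalues
  exact (measurable_pi_apply _).comp h1

theorem Matrix.IsHermitian.trace_pow_eq_sum_eigenvalues {A : Matrix (Fin N) (Fin N) ℂ}
    (hA : A.IsHermitian) (k : ℕ) : (A ^ k).trace = ∑ i, (hA.eigenvalues i : ℂ) ^ k := by
  conv_lhs => rw [hA.spectral_theorem]
  rw [← map_pow, Unitary.conjStarAlgAut_apply, Matrix.trace_mul_cycle, Unitary.coe_star_mul_self,
    one_mul, Matrix.diagonal_pow, Matrix.trace_diagonal]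
  rfl

end Eigenvalues

/-! ### Hermite polynomials and the normalizing constant -/

theorem integrable_polynomial_eval_gaussianReal (q : Polynomial ℝ) :
    Integrable (fun x => q.eval x) (gaussianReal 0 1) := by
  simp only [Polynomial.eval_eq_sum, Polynomial.sum]
  exact integrable_finsetSum _ fun n _ => (integrable_pow_gaussianReal n).const_mul _

/-- Gaussian integration by parts in dimension one. -/
theorem integral_X_mul_eval_gaussianReal (q : Polynomial ℝ) :
    ∫ x, (Polynomial.X * q).eval x ∂(gaussianReal 0 1) =
      ∫ x, q.derivative.eval x ∂(gaussianReal 0 1) := by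
  induction q using Polynomial.induction_on' with
  | add p q hp hq =>
    simp only [mul_add, Polynomial.eval_add, Polynomial.derivative_add]
    rw [integral_add (integrable_polynomial_eval_gaussianReal _)
      (integrable_polynomial_eval_gaussianReal _),
      integral_add (integrable_polynomial_eval_gaussianReal _)
      (integrable_polynomial_eval_gaussianReal _), hp, hq]
  | monomial n a =>
    rw [Polynomial.X_mul_monomial, Polynomial.derivative_monomial]
    simp only [Polynomial.eval_monomial]
    rw [integral_const_mul, integral_const_mul, integral_pow_succ_gaussianReal, mul_assoc]

/-- The probabilists' Hermite polynomial with real coefficients. -/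
noncomputable def realHermite (n : ℕ) : Polynomial ℝ :=
  (Polynomial.hermite n).map (Int.castRingHom ℝ)

/-- The recursion `H_(n+1) = X H_n - H_n'` is such that one integration by parts moves one
derivative onto `q`. -/
theorem integral_realHermite_mul (n : ℕ) (q : Polynomial ℝ) :
    ∫ x, (realHermite n * q).eval x ∂(gaussianReal 0 1) =
      ∫ x, (Polynomial.derivative^[n] q).eval x ∂(gaussianReal 0 1) := by
  induction n generalizing q with
  | zero => simp [realHermite]
  | succ n ih =>
    have h : realHermite (n + 1) * q = Polynomial.X * (realHermite n * q) -
        (realHermite n).derivative * q := by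
      simp only [realHermite, Polynomial.hermite_succ, Polynomial.map_sub, Polynomial.map_mul,
        Polynomial.map_X, Polynomial.derivative_map]
      ring
    rw [h]
    simp only [Polynomial.eval_sub]
    rw [integral_sub (integrable_polynomial_eval_gaussianReal _)
      (integrable_polynomial_eval_gaussianReal _), integral_X_mul_eval_gaussianReal,
      Polynomial.derivative_mul]
    simp only [Polynomial.eval_add]
    rw [integral_add (integrable_polynomial_eval_gaussianReal _)
      (integrable_polynomial_eval_gaussianReal _), ih, add_sub_cancel_left,
      Function.iterate_succ_apply]

theorem natDegree_realHermite (n : ℕ) : (realHermite n).natDegree = n := by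
  rw [realHermite, (Polynomial.hermite_monic n).natDegree_map, Polynomial.natDegree_hermite]

theorem realHermite_monic (n : ℕ) : (realHermite n).Monic := (Polynomial.hermite_monic n).map _

/-- Orthogonality of the Hermite polynomials. -/
theorem integral_realHermite_mul_realHermite (m n : ℕ) :
    ∫ x, (realHermite m * realHermite n).eval x ∂(gaussianReal 0 1) =
      if m = n then (m.factorial : ℝ) else 0 := by
  have hlt : ∀ {m n : ℕ}, n < m →
      ∫ x, (realHermite m * realHermite n).eval x ∂(gaussianReal 0 1) = 0 := by
    intro m n h
    rw [integral_realHermite_mul, Polynomial.iterate_derivative_eq_zero]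
    · simp
    · rwa [natDegree_realHermite]
  rcases lt_trichotomy m n with h | rfl | h
  · rw [mul_comm, hlt h, if_neg h.ne]
  · rw [integral_realHermite_mul, if_pos rfl]
    have h0 : Polynomial.derivative^[m] (realHermite m) = Polynomial.C (m.factorial : ℝ) := by
      ext k
      rw [Polynomial.coeff_iterate_derivative, Polynomial.coeff_C]
      split_ifs with hk
      · subst hk
        have := (realHermite_monic m).coeff_natDegree
        rw [natDegree_realHermite] at this
        rw [zero_add, this, Nat.descFactorial_self]
        simp
      · rw [Polynomial.coeff_eq_zero_of_natDegree_lt, smul_zero]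
        rw [natDegree_realHermite]
        omega
    simp [h0]
  · rw [hlt h, if_neg h.ne']

/-- The Vandermonde product `∏ i < j, (x i - x j)`. -/
noncomputable def vandermondeProd {N : ℕ} {R : Type*} [CommRing R] (x : Fin N → R) : R :=
  ∏ i : Fin N, ∏ j ∈ Finset.Ioi i, (x i - x j)

/-- Monic polynomials of degrees `0, …, N - 1` have the Vandermonde determinant. Squaring removes
the sign due to `x i - x j` against `x j - x i`. -/
theorem vandermondeProd_sq_eq_det_sq {N : ℕ} (x : Fin N → ℝ) : vandermondeProd x ^ 2 =
    (Matrix.of fun i j : Fin N => (realHermite i).eval (x j)).det ^ 2 := by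
  have h := Matrix.det_eval_matrixOfPolynomials_eq_det_vandermonde x
    (fun i : Fin N => realHermite i) (fun i => natDegree_realHermite i)
    fun i => realHermite_monic i
  rw [← Matrix.det_transpose (Matrix.of fun i j : Fin N => (realHermite i).eval (x j))]
  have h2 : (Matrix.of fun i j : Fin N => (realHermite i).eval (x j)).transpose =
      Matrix.of fun i j : Fin N => (realHermite j).eval (x i) := rfl
  rw [h2, ← h, Matrix.det_vandermonde, vandermondeProd]
  simp only [← Finset.prod_pow]
  exact Finset.prod_congr rfl fun i _ => Finset.prod_congr rfl fun j _ => by ring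

theorem factorial_mul_prod_factorial (N : ℕ) :
    N.factorial * ∏ i : Fin N, (i : ℕ).factorial = ∏ k ∈ Finset.Icc 1 N, k.factorial := by
  rw [Fin.prod_univ_eq_prod_range (fun i => i.factorial) N]
  induction N with
  | zero => simp
  | succ N ih =>
    rw [Finset.prod_range_succ, Finset.prod_Icc_succ_top (by omega), ← ih]
    ring

/-- The normalization of the tilted Gaussian measure. -/
theorem integral_vandermondeProd_sq (N : ℕ) :
    ∫ x : Fin N → ℝ, vandermondeProd x ^ 2 ∂(stdGaussianPi (Fin N)) =
      ∏ k ∈ Finset.Icc 1 N, (k.factorial : ℝ) := by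
  have hexp : ∀ x : Fin N → ℝ, vandermondeProd x ^ 2 =
      ∑ s : Equiv.Perm (Fin N), ∑ t : Equiv.Perm (Fin N),
        ((Equiv.Perm.sign s : ℤ) * (Equiv.Perm.sign t : ℤ) : ℝ) *
          ∏ i, (realHermite (s i) * realHermite (t i)).eval (x i) := fun x => by
    rw [vandermondeProd_sq_eq_det_sq, Matrix.det_apply', sq, Finset.sum_mul_sum]
    refine Finset.sum_congr rfl fun s _ => Finset.sum_congr rfl fun t _ => ?_
    simp only [Polynomial.eval_mul, Finset.prod_mul_distrib, Matrix.of_apply]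
    ring
  have hint : ∀ s t : Equiv.Perm (Fin N), Integrable (fun x : Fin N → ℝ =>
      ((Equiv.Perm.sign s : ℤ) * (Equiv.Perm.sign t : ℤ) : ℝ) *
          ∏ i, (realHermite (s i) * realHermite (t i)).eval (x i)) (stdGaussianPi (Fin N)) :=
    fun s t => Integrable.const_mul (Integrable.fintype_prod
      (f := fun i y => (realHermite (s i) * realHermite (t i)).eval y)
      fun i => integrable_polynomial_eval_gaussianReal _) _
  simp only [hexp]
  rw [integral_finsetSum _ fun s _ => integrable_finsetSum _ fun t _ => hint s t]
  -- In the expanded squared determinant, orthogonality kills every `t ≠ s`. Each of the `N!`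
  -- permutations `s` then contributes `∏ i!`.
  have hs : ∀ s : Equiv.Perm (Fin N), ∫ x : Fin N → ℝ, ∑ t : Equiv.Perm (Fin N),
        ((Equiv.Perm.sign s : ℤ) * (Equiv.Perm.sign t : ℤ) : ℝ) *
          ∏ i, (realHermite (s i) * realHermite (t i)).eval (x i) ∂(stdGaussianPi (Fin N)) =
      ∏ i : Fin N, ((i : ℕ).factorial : ℝ) := fun s => by
    rw [integral_finsetSum _ fun t _ => hint s t]
    have ht : ∀ t : Equiv.Perm (Fin N), ∫ x : Fin N → ℝ,
        ((Equiv.Perm.sign s : ℤ) * (Equiv.Perm.sign t : ℤ) : ℝ) *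
          ∏ i, (realHermite (s i) * realHermite (t i)).eval (x i) ∂(stdGaussianPi (Fin N)) =
        ((Equiv.Perm.sign s : ℤ) * (Equiv.Perm.sign t : ℤ) : ℝ) *
          ∏ i, if (s i : ℕ) = t i then ((s i : ℕ).factorial : ℝ) else 0 := fun t => by
      rw [integral_const_mul, integral_fintype_prod_eq_prod
        (f := fun i y => (realHermite (s i) * realHermite (t i)).eval y)]
      simp only [integral_realHermite_mul_realHermite]
    simp only [ht]
    rw [Finset.sum_eq_single s]
    · have hsign : ((Equiv.Perm.sign s : ℤ) * (Equiv.Perm.sign s : ℤ) : ℝ) = 1 := by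
        rw [← Int.cast_mul, ← Units.val_mul, Int.units_mul_self]
        simp
      simp only [hsign, one_mul, if_true]
      exact Equiv.prod_comp s fun i => ((i : ℕ).factorial : ℝ)
    · intro t _ hts
      obtain ⟨i, hi⟩ : ∃ i, s i ≠ t i := by
        by_contra! hc
        exact hts (Equiv.ext fun i => (hc i).symm)
      rw [Finset.prod_eq_zero (Finset.mem_univ i), mul_zero]
      exact if_neg fun h => hi (Fin.ext h)
    · simp
  simp only [hs]
  rw [Finset.sum_const, Finset.card_univ, Fintype.card_perm, Fintype.card_fin, nsmul_eq_mul]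
  exact_mod_cast factorial_mul_prod_factorial N

/-! ### The density relative to the standard Gaussian measure -/

theorem stdGaussianPi_eq_withDensity (N : ℕ) : stdGaussianPi (Fin N) =
    (volume : Measure (Fin N → ℝ)).withDensity
      fun x => ENNReal.ofReal (∏ i, gaussianPDFReal 0 1 (x i)) := by
  refine Measure.pi_eq fun s hs => ?_
  rw [withDensity_apply _ (MeasurableSet.univ_pi hs), volume_pi, Measure.restrict_pi_pi,
    ← ofReal_integral_eq_lintegral_ofReal,
    integral_fintype_prod_eq_prod (f := fun _ y => gaussianPDFReal 0 1 y),
    ENNReal.ofReal_prod_of_nonneg]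
  · exact Finset.prod_congr rfl fun i _ =>
      (gaussianReal_apply_eq_integral 0 one_ne_zero (s i)).symm
  · exact fun i _ => integral_nonneg fun x => gaussianPDFReal_nonneg _ _ _
  · exact Integrable.fintype_prod (f := fun _ y => gaussianPDFReal 0 1 y) fun i =>
      (integrable_gaussianPDFReal 0 1).restrict
  · exact ae_of_all _ fun x => Finset.prod_nonneg fun i _ => gaussianPDFReal_nonneg _ _ _

theorem withDensity_gueEigenvalueDensity (N : ℕ) :
    (volume : Measure (Fin N → ℝ)).withDensity
        (fun x => ENNReal.ofReal (gueEigenvalueDensity N x)) =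
      (stdGaussianPi (Fin N)).withDensity fun x =>
        ENNReal.ofReal ((∏ k ∈ Finset.Icc 1 N, (k.factorial : ℝ))⁻¹ * vandermondeProd x ^ 2) := by
  have hV : Measurable fun x : Fin N → ℝ => vandermondeProd x := by
    unfold vandermondeProd
    fun_prop
  have hpdf : Measurable fun x : Fin N → ℝ => ∏ i, gaussianPDFReal 0 1 (x i) :=
    Finset.measurable_prod _ fun i _ =>
      (measurable_gaussianPDFReal 0 1).comp (measurable_pi_apply i)
  rw [stdGaussianPi_eq_withDensity, ← withDensity_mul _ (by fun_prop) (by fun_prop)]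
  congr 1
  funext x
  rw [Pi.mul_apply, ← ENNReal.ofReal_mul
    (Finset.prod_nonneg fun i _ => gaussianPDFReal_nonneg _ _ _)]
  congr 1
  have h1 : ∏ i, gaussianPDFReal 0 1 (x i) =
      ((2 * Real.pi) ^ ((N : ℝ) / 2))⁻¹ * ∏ i, Real.exp (-(x i) ^ 2 / 2) := by
    simp only [gaussianPDFReal, Finset.prod_mul_distrib, NNReal.coe_one, mul_one, sub_zero,
      Finset.prod_const, Finset.card_univ, Fintype.card_fin]
    rw [inv_pow, Real.sqrt_eq_rpow, ← Real.rpow_natCast, ← Real.rpow_mul (by positivity)]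
    congr 3
    ring
  rw [h1, gueEigenvalueDensity, vandermondeProd]
  simp only [← Finset.prod_pow]
  rw [div_eq_mul_inv, mul_inv]
  ring

/-! ### The Hermitian matrix in Gaussian coordinates -/

section GenericHermitian

variable {N : ℕ}

/-- The off-diagonal entry `(x + ε y) / √2` of the generic Hermitian matrix, where `ε = ± I`. -/
noncomputable def offDiagEntry (ε : ℂ) (p : {p : Fin N × Fin N // p.1 < p.2}) :
    MvPolynomial (HermitianIndex N) ℂ :=
  MvPolynomial.C ((√2 : ℝ) : ℂ)⁻¹ * (MvPolynomial.X (Sum.inr (Sum.inl p)) +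
    MvPolynomial.C ε * MvPolynomial.X (Sum.inr (Sum.inr p)))

/-- The derivation `(∂ x + ε ∂ y) / √2`, where `ε = ± I`. -/
noncomputable def offDiagDeriv (ε : ℂ) (p : {p : Fin N × Fin N // p.1 < p.2}) :
    Derivation ℂ (MvPolynomial (HermitianIndex N) ℂ) (MvPolynomial (HermitianIndex N) ℂ) :=
  ((√2 : ℝ) : ℂ)⁻¹ • (MvPolynomial.pderiv (Sum.inr (Sum.inl p)) +
    ε • MvPolynomial.pderiv (Sum.inr (Sum.inr p)))

/-- The Hermitian matrix whose real coordinates are the variables of a polynomial ring. -/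
noncomputable def genericHermitian (N : ℕ) :
    Matrix (Fin N) (Fin N) (MvPolynomial (HermitianIndex N) ℂ) := fun i j =>
  if h : i < j then offDiagEntry Complex.I ⟨(i, j), h⟩
  else if h : j < i then offDiagEntry (-Complex.I) ⟨(j, i), h⟩
  else MvPolynomial.X (Sum.inl i)

/-- The derivative with respect to the entry `(j, i)` of the generic Hermitian matrix. -/
noncomputable def hermitianDeriv (i j : Fin N) : Derivation ℂ
    (MvPolynomial (HermitianIndex N) ℂ) (MvPolynomial (HermitianIndex N) ℂ) :=
  if h : i < j then offDiagDeriv Complex.I ⟨(i, j), h⟩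
  else if h : j < i then offDiagDeriv (-Complex.I) ⟨(j, i), h⟩
  else MvPolynomial.pderiv (Sum.inl i)

theorem ofReal_sqrt_two_mul_self : ((√2 : ℝ) : ℂ) * ((√2 : ℝ) : ℂ) = 2 := by
  rw [← Complex.ofReal_mul, Real.mul_self_sqrt (by norm_num)]
  norm_num

theorem pderiv_X_eq_ite (a b : HermitianIndex N) :
    MvPolynomial.pderiv a (MvPolynomial.X b) =
      (if a = b then 1 else 0 : MvPolynomial (HermitianIndex N) ℂ) := by
  rw [MvPolynomial.pderiv_X, Pi.single_apply]
  simp [eq_comm]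

/-- These act as Wirtinger derivatives: for `ε = ± I` the factor `(1 + ε η) / 2` is 0 at `η = ε` and
1 at `η = -ε`, so an entry is killed by its own derivation and paired with that of its conjugate. -/
theorem offDiagDeriv_offDiagEntry (ε η : ℂ) (p q : {p : Fin N × Fin N // p.1 < p.2}) :
    offDiagDeriv ε p (offDiagEntry η q) =
      if p = q then MvPolynomial.C (2⁻¹ * (1 + ε * η)) else 0 := by
  have h2 : ((√2 : ℝ) : ℂ)⁻¹ * ((√2 : ℝ) : ℂ)⁻¹ = 2⁻¹ := by
    rw [← mul_inv, ofReal_sqrt_two_mul_self]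
  simp only [offDiagDeriv, offDiagEntry, Derivation.smul_apply, Derivation.add_apply,
    MvPolynomial.pderiv_C_mul, map_add, pderiv_X_eq_ite, Sum.inr.injEq, Sum.inl.injEq,
    reduceCtorEq, if_false, mul_zero, add_zero, zero_add]
  split_ifs
  · rw [← h2]
    simp only [MvPolynomial.smul_eq_C_mul, map_mul, map_add, map_one]
    ring
  · simp

theorem offDiagDeriv_X_inl (ε : ℂ) (p : {p : Fin N × Fin N // p.1 < p.2}) (k : Fin N) :
    offDiagDeriv ε p (MvPolynomial.X (Sum.inl k)) = 0 := by
  simp [offDiagDeriv]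

theorem pderiv_inl_offDiagEntry (ε : ℂ) (p : {p : Fin N × Fin N // p.1 < p.2}) (k : Fin N) :
    MvPolynomial.pderiv (Sum.inl k) (offDiagEntry ε p) = 0 := by
  simp [offDiagEntry]

theorem hermitianDeriv_genericHermitian (i j k l : Fin N) :
    hermitianDeriv i j (genericHermitian N k l) = if j = k ∧ i = l then 1 else 0 := by
  unfold hermitianDeriv genericHermitian
  rcases lt_trichotomy i j with hij | hij | hij <;> rcases lt_trichotomy k l with hkl | hkl | hkl
  all_goals
    simp only [hij, hkl, hij.not_gt, hkl.not_gt, lt_irrefl, dite_true, dite_false,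
      offDiagDeriv_offDiagEntry, offDiagDeriv_X_inl, pderiv_inl_offDiagEntry, pderiv_X_eq_ite,
      Subtype.mk.injEq, Prod.mk.injEq, Sum.inl.injEq]
  all_goals norm_num
  all_goals first | omega | exact if_congr and_comm rfl rfl

/-- The entry and the derivation are the same linear combination, of variables and of partial
derivatives respectively, so the scalar integration by parts extends linearly. -/
theorem gaussianExpectation_genericHermitian_mul (i j : Fin N)
    (f : MvPolynomial (HermitianIndex N) ℂ) :
    gaussianExpectation _ (genericHermitian N i j * f) =
      gaussianExpectation _ (hermitianDeriv i j f) := by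
  have hoff : ∀ ε p, gaussianExpectation _ (offDiagEntry ε p * f) =
      gaussianExpectation (HermitianIndex N) (offDiagDeriv ε p f) := fun ε p => by
    rw [offDiagEntry, offDiagDeriv, Derivation.smul_apply, Derivation.add_apply,
      Derivation.smul_apply, mul_assoc, add_mul, mul_assoc, ← MvPolynomial.smul_eq_C_mul,
      ← MvPolynomial.smul_eq_C_mul, map_smul, map_smul, map_add, map_add, map_smul, map_smul,
      gaussianExpectation_X_mul, gaussianExpectation_X_mul]
  unfold hermitianDeriv genericHermitian
  split_ifs
  · exact hoff _ _
  · exact hoff _ _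
  · exact gaussianExpectation_X_mul _ _

theorem eval_genericHermitian {A : Matrix (Fin N) (Fin N) ℂ} (hA : A.IsHermitian) :
    (genericHermitian N).map (MvPolynomial.eval fun a => (hermitianCoord A a : ℂ)) = A := by
  have hs : ((√2 : ℝ) : ℂ) ≠ 0 := by
    intro h
    have := ofReal_sqrt_two_mul_self
    rw [h] at this
    norm_num at this
  have hoff : ∀ ε p, MvPolynomial.eval (fun a => (hermitianCoord A a : ℂ)) (offDiagEntry ε p) =
      (A p.1.1 p.1.2).re + ε * (A p.1.1 p.1.2).im := fun ε p => by
    simp only [offDiagEntry, map_mul, map_add, MvPolynomial.eval_C, MvPolynomial.eval_X,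
      hermitianCoord, Complex.ofReal_mul]
    field_simp
  ext i j
  rw [Matrix.map_apply]
  unfold genericHermitian
  split_ifs with h h'
  · rw [hoff, mul_comm, Complex.re_add_im]
  · rw [hoff, ← hA.apply i j]
    apply Complex.ext <;> simp
  · obtain rfl : i = j := le_antisymm (not_lt.1 h') (not_lt.1 h)
    rw [MvPolynomial.eval_X]
    exact hA.coe_re_apply_self i

/-- Traces of powers of the Gaussian Hermitian matrix satisfy the loop equations. -/
theorem satisfiesLoopEquations_genericHermitian (N : ℕ) : SatisfiesLoopEquations N
    (gaussianExpectation (HermitianIndex N) ∘ₗ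
      (MvPolynomial.aeval (R := ℂ) fun k => (genericHermitian N ^ k).trace).toLinearMap) := by
  refine satisfiesLoopEquations_of_matrix (genericHermitian N) hermitianDeriv (fun i j => ?_) _
    gaussianExpectation_one gaussianExpectation_genericHermitian_mul
  ext1 k l
  rw [Matrix.map_apply, hermitianDeriv_genericHermitian, Matrix.single_apply]

/-- Each off-diagonal entry occurs twice in the trace, which the factor `√2` in the coordinates
absorbs. Exponential moments of the spectrum thereby reduce to those of the coordinates. -/
theorem trace_sq_eq_sum_hermitianCoord_sq {A : Matrix (Fin N) (Fin N) ℂ} (hA : A.IsHermitian) :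
    (A ^ 2).trace = ((∑ a, hermitianCoord A a ^ 2 : ℝ) : ℂ) := by
  have h1 : (A ^ 2).trace = ((∑ i, ∑ j, Complex.normSq (A i j) : ℝ) : ℂ) := by
    rw [sq, Matrix.trace]
    push_cast
    refine Finset.sum_congr rfl fun i _ => ?_
    rw [Matrix.diag_apply, Matrix.mul_apply]
    refine Finset.sum_congr rfl fun j _ => ?_
    rw [← hA.apply j i, Complex.normSq_eq_conj_mul_self, mul_comm]
    rfl
  rw [h1, Finset.sum_sum_eq_diag_add_two_mul]
  · congr 1
    have hsub : ∀ g : Fin N → Fin N → ℝ, ∑ p : {p : Fin N × Fin N // p.1 < p.2}, g p.1.1 p.1.2 =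
        ∑ i, ∑ j ∈ Finset.Ioi i, g i j := fun g => by
      rw [← Finset.sum_subtype (Finset.univ.filter fun p : Fin N × Fin N => p.1 < p.2) (by simp)
        fun p => g p.1 p.2, Finset.sum_filter, Fintype.sum_prod_type]
      refine Finset.sum_congr rfl fun i _ => ?_
      rw [← Finset.sum_filter]
      congr 1
      ext j
      simp
    rw [Fintype.sum_sum_type, Fintype.sum_sum_type]
    simp only [hermitianCoord, mul_pow, Real.sq_sqrt (show (0 : ℝ) ≤ 2 by norm_num)]
    rw [hsub fun i j => 2 * (A i j).re ^ 2, hsub fun i j => 2 * (A i j).im ^ 2,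
      ← Finset.sum_add_distrib, Finset.mul_sum]
    congr 1
    · refine Finset.sum_congr rfl fun i _ => ?_
      rw [Complex.normSq_apply, ← hA.coe_re_apply_self i]
      simp [sq]
    · refine Finset.sum_congr rfl fun i _ => ?_
      rw [← Finset.sum_add_distrib, Finset.mul_sum]
      refine Finset.sum_congr rfl fun j _ => ?_
      rw [Complex.normSq_apply]
      ring
  · intro i j
    rw [← hA.apply j i]
    exact (Complex.normSq_conj _).symm

end GenericHermitian

/-! ### Integrability from Gaussian exponential moments -/

section ExponentialMoments

variable {σ : Type*} [Fintype σ]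

/-- Polynomials are dominated by a small Gaussian exponential. -/
theorem exists_norm_eval_le_exp (f : MvPolynomial σ ℂ) : ∃ C : ℝ, ∀ x : σ → ℝ,
    ‖MvPolynomial.eval (fun i => (x i : ℂ)) f‖ ≤ C * Real.exp ((∑ i, x i ^ 2) / 8) := by
  have hpoly : ∃ (C : ℝ) (k : ℕ), 0 ≤ C ∧ ∀ x : σ → ℝ,
      ‖MvPolynomial.eval (fun i => (x i : ℂ)) f‖ ≤ C * (1 + ∑ i, x i ^ 2) ^ k := by
    induction f using MvPolynomial.induction_on with
    | C a => exact ⟨‖a‖, 0, norm_nonneg a, fun x => by simp⟩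
    | add p q hp hq =>
      obtain ⟨C, k, hC, h⟩ := hp
      obtain ⟨D, l, hD, h'⟩ := hq
      refine ⟨C + D, k + l, add_nonneg hC hD, fun x => ?_⟩
      have h1 : (1 : ℝ) ≤ 1 + ∑ i, x i ^ 2 := by
        have := Finset.sum_nonneg (s := Finset.univ) fun i _ => sq_nonneg (x i)
        linarith
      rw [map_add, add_mul]
      refine (norm_add_le _ _).trans (add_le_add ((h x).trans ?_) ((h' x).trans ?_))
      · exact mul_le_mul_of_nonneg_left (pow_le_pow_right₀ h1 (Nat.le_add_right _ _)) hC
      · exact mul_le_mul_of_nonneg_left (pow_le_pow_right₀ h1 (Nat.le_add_left _ _)) hD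
    | mul_X p i hp =>
      obtain ⟨C, k, hC, h⟩ := hp
      refine ⟨C, k + 1, hC, fun x => ?_⟩
      rw [map_mul, MvPolynomial.eval_X, norm_mul, pow_succ, ← mul_assoc, Complex.norm_real,
        Real.norm_eq_abs]
      have h1 : |x i| ≤ 1 + ∑ i, x i ^ 2 := by
        have := Finset.single_le_sum (f := fun i => x i ^ 2) (fun i _ => sq_nonneg (x i))
          (Finset.mem_univ i)
        have h2 : 2 * |x i| ≤ 1 + x i ^ 2 := by
          have := sq_nonneg (|x i| - 1)
          rw [sub_sq, sq_abs] at this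
          linarith
        have h3 := abs_nonneg (x i)
        linarith
      exact mul_le_mul (h x) h1 (abs_nonneg _) (by positivity)
  obtain ⟨C, k, hC, h⟩ := hpoly
  -- The constant comes from `s ^ k / k! ≤ exp s` at `s = (1 + ∑ x_i^2) / 8`.
  refine ⟨C * (8 ^ k * k.factorial * Real.exp (1 / 8)), fun x => (h x).trans ?_⟩
  rw [mul_assoc C]
  refine mul_le_mul_of_nonneg_left ?_ hC
  have hs : 0 ≤ (1 + ∑ i, x i ^ 2) / 8 := by positivity
  have := Real.pow_div_factorial_le_exp _ hs k
  rw [div_le_iff₀ (by positivity), div_pow, div_le_iff₀ (by positivity), add_div,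
    Real.exp_add] at this
  linarith

theorem measurable_eval_ofReal (f : MvPolynomial σ ℂ) :
    Measurable fun x : σ → ℝ => MvPolynomial.eval (fun i => (x i : ℂ)) f :=
  ((MvPolynomial.continuous_eval f).comp (by fun_prop)).measurable

theorem integrable_eval_of_integrable_exp_sq {μ : Measure (σ → ℝ)}
    (h : Integrable (fun x : σ → ℝ => Real.exp ((∑ i, x i ^ 2) / 8)) μ) (f : MvPolynomial σ ℂ) :
    Integrable (fun x : σ → ℝ => MvPolynomial.eval (fun i => (x i : ℂ)) f) μ := by
  obtain ⟨C, hC⟩ := exists_norm_eval_le_exp f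
  exact (h.const_mul C).mono' (measurable_eval_ofReal f).aestronglyMeasurable (ae_of_all _ hC)

theorem integrable_exp_sum_mul_of_integrable_exp_sq {μ : Measure (σ → ℝ)}
    (h : Integrable (fun x : σ → ℝ => Real.exp ((∑ i, x i ^ 2) / 8)) μ) (u : σ → ℝ) :
    Integrable (fun x : σ → ℝ => Real.exp (∑ i, u i * x i)) μ := by
  refine (h.const_mul (Real.exp (∑ i, 2 * u i ^ 2))).mono'
    (Continuous.aestronglyMeasurable (by fun_prop)) (ae_of_all _ fun x => ?_)
  rw [Real.norm_eq_abs, Real.abs_exp, ← Real.exp_add, Real.exp_le_exp, Finset.sum_div,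
    ← Finset.sum_add_distrib]
  refine Finset.sum_le_sum fun i _ => ?_
  -- This square gives `u x ≤ 2 u^2 + x^2 / 8`.
  have := sq_nonneg (4 * u i - x i)
  nlinarith

theorem integrable_exp_sq_stdGaussianPi {c : ℝ} (hc : c < 1 / 2) :
    Integrable (fun x : σ → ℝ => Real.exp (c * ∑ i, x i ^ 2)) (stdGaussianPi σ) := by
  have h1 : Integrable (fun x : ℝ => Real.exp (c * x ^ 2)) (gaussianReal 0 1) := by
    rw [integrable_gaussianPDFReal_mul_iff]
    have := (integrable_exp_neg_mul_sq (b := 1 / 2 - c) (by linarith)).const_mul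
      (√(2 * Real.pi * ((1 : NNReal) : ℝ)))⁻¹
    refine this.congr (ae_of_all _ fun x => ?_)
    simp only [gaussianPDFReal]
    rw [mul_assoc _ (Real.exp _) (Real.exp _), ← Real.exp_add]
    congr 2
    simp only [NNReal.coe_one]
    ring
  have h2 := Integrable.fintype_prod (ι := σ) (f := fun _ x => Real.exp (c * x ^ 2))
    (μ := fun _ => gaussianReal 0 1) fun _ => h1
  refine h2.congr (ae_of_all _ fun x => ?_)
  simp only [← Real.exp_sum, Finset.mul_sum]

end ExponentialMoments

/-! ### The candidate eigenvalue law -/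

section Density

variable {N : ℕ}

theorem measurable_vandermondeProd : Measurable fun x : Fin N → ℝ => vandermondeProd x := by
  unfold vandermondeProd
  fun_prop

theorem vandermondeProd_comp_perm_sq (τ : Equiv.Perm (Fin N)) (x : Fin N → ℝ) :
    vandermondeProd (fun i => x (τ i)) ^ 2 = vandermondeProd x ^ 2 := by
  rw [vandermondeProd_sq_eq_det_sq, vandermondeProd_sq_eq_det_sq]
  have h : (Matrix.of fun i j : Fin N => (realHermite i).eval (x (τ j))) =
      (Matrix.of fun i j : Fin N => (realHermite i).eval (x j)).submatrix id τ := rfl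
  rw [h, Matrix.det_permute', mul_pow]
  have hsign : ((Equiv.Perm.sign τ : ℤ) : ℝ) ^ 2 = 1 := by
    rw [sq, ← Int.cast_mul, ← Units.val_mul, Int.units_mul_self]
    simp
  rw [hsign, one_mul]

theorem eval_vandermondeProd_X (x : Fin N → ℝ) :
    MvPolynomial.eval (fun i => (x i : ℂ)) (vandermondeProd fun i => MvPolynomial.X i) =
      ((vandermondeProd x : ℝ) : ℂ) := by
  simp [vandermondeProd]

theorem prod_factorial_pos (N : ℕ) : 0 < ∏ k ∈ Finset.Icc 1 N, (k.factorial : ℝ) :=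
  Finset.prod_pos fun k _ => by exact_mod_cast k.factorial_pos

/-- The density of the eigenvalue law with respect to the standard Gaussian measure. -/
noncomputable def gueTilt (N : ℕ) (x : Fin N → ℝ) : ℝ :=
  (∏ k ∈ Finset.Icc 1 N, (k.factorial : ℝ))⁻¹ * vandermondeProd x ^ 2

theorem gueTilt_nonneg (x : Fin N → ℝ) : 0 ≤ gueTilt N x :=
  mul_nonneg (inv_nonneg.2 (prod_factorial_pos N).le) (sq_nonneg _)

theorem measurable_gueTilt : Measurable (gueTilt N) :=
  (measurable_vandermondeProd.pow_const 2).const_mul _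

/-- The law on `ℝ^N` with density `gueTilt N` with respect to the standard Gaussian measure. -/
noncomputable def gueEigenvalueLaw (N : ℕ) : Measure (Fin N → ℝ) :=
  (stdGaussianPi (Fin N)).withDensity fun x => ENNReal.ofReal (gueTilt N x)

theorem integrable_gueEigenvalueLaw_iff {E : Type*} [NormedAddCommGroup E] [NormedSpace ℝ E]
    {f : (Fin N → ℝ) → E} : Integrable f (gueEigenvalueLaw N) ↔
      Integrable (fun x => gueTilt N x • f x) (stdGaussianPi (Fin N)) := by
  rw [gueEigenvalueLaw, integrable_withDensity_iff_integrable_smul'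
    measurable_gueTilt.ennreal_ofReal (ae_of_all _ fun x => ENNReal.ofReal_lt_top)]
  simp only [ENNReal.toReal_ofReal (gueTilt_nonneg _)]

theorem integral_gueEigenvalueLaw {E : Type*} [NormedAddCommGroup E] [NormedSpace ℝ E]
    (f : (Fin N → ℝ) → E) : ∫ x, f x ∂(gueEigenvalueLaw N) =
      ∫ x, gueTilt N x • f x ∂(stdGaussianPi (Fin N)) := by
  rw [gueEigenvalueLaw, integral_withDensity_eq_integral_toReal_smul
    measurable_gueTilt.ennreal_ofReal (ae_of_all _ fun x => ENNReal.ofReal_lt_top)]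
  simp only [ENNReal.toReal_ofReal (gueTilt_nonneg _)]

/-- Makes the integrability and growth bounds for complex polynomials available for the tilt. -/
theorem gueTilt_eq_norm_eval (x : Fin N → ℝ) : gueTilt N x =
    (∏ k ∈ Finset.Icc 1 N, (k.factorial : ℝ))⁻¹ * ‖MvPolynomial.eval (fun i => (x i : ℂ))
      ((vandermondeProd fun i => MvPolynomial.X i) ^ 2)‖ := by
  rw [map_pow, eval_vandermondeProd_X, norm_pow, Complex.norm_real, Real.norm_eq_abs, sq_abs,
    gueTilt]

theorem integrable_gueTilt : Integrable (gueTilt N) (stdGaussianPi (Fin N)) := by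
  have := ((integrable_eval_stdGaussianPi (σ := Fin N)
    ((vandermondeProd fun i => MvPolynomial.X i) ^ 2)).norm.const_mul
    (∏ k ∈ Finset.Icc 1 N, (k.factorial : ℝ))⁻¹)
  exact this.congr (ae_of_all _ fun x => (gueTilt_eq_norm_eval x).symm)

theorem isProbabilityMeasure_gueEigenvalueLaw (N : ℕ) :
    IsProbabilityMeasure (gueEigenvalueLaw N) := by
  refine ⟨?_⟩
  rw [gueEigenvalueLaw, withDensity_apply _ MeasurableSet.univ, Measure.restrict_univ,
    ← ofReal_integral_eq_lintegral_ofReal integrable_gueTilt (ae_of_all _ gueTilt_nonneg)]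
  simp only [gueTilt]
  rw [integral_const_mul, integral_vandermondeProd_sq, inv_mul_cancel₀ (prod_factorial_pos N).ne',
    ENNReal.ofReal_one]

theorem integrable_exp_sq_gueEigenvalueLaw (N : ℕ) : Integrable
    (fun x : Fin N → ℝ => Real.exp ((∑ i, x i ^ 2) / 8)) (gueEigenvalueLaw N) := by
  rw [integrable_gueEigenvalueLaw_iff]
  obtain ⟨C, hC⟩ := exists_norm_eval_le_exp (σ := Fin N)
    ((vandermondeProd fun i => MvPolynomial.X i) ^ 2)
  -- One eighth bounds the polynomial tilt and one eighth is the exponential itself; their sum stays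
  -- below 1/2.
  have h := integrable_exp_sq_stdGaussianPi (σ := Fin N) (c := 1 / 4) (by norm_num)
  refine (h.const_mul ((∏ k ∈ Finset.Icc 1 N, (k.factorial : ℝ))⁻¹ * C)).mono'
    (measurable_gueTilt.aestronglyMeasurable.smul
      (Continuous.aestronglyMeasurable (by fun_prop))) (ae_of_all _ fun x => ?_)
  rw [smul_eq_mul, norm_mul, Real.norm_of_nonneg (gueTilt_nonneg x), Real.norm_eq_abs,
    Real.abs_exp, gueTilt_eq_norm_eval, mul_assoc, mul_assoc]
  refine mul_le_mul_of_nonneg_left ?_ (inv_nonneg.2 (prod_factorial_pos N).le)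
  refine (mul_le_mul_of_nonneg_right (hC x) (Real.exp_pos _).le).trans_eq ?_
  rw [mul_assoc, ← Real.exp_add]
  congr 2
  ring

theorem map_perm_stdGaussianPi (τ : Equiv.Perm (Fin N)) :
    (stdGaussianPi (Fin N)).map (fun x i => x (τ i)) = stdGaussianPi (Fin N) := by
  refine (Measure.pi_eq fun s hs => ?_).symm
  rw [Measure.map_apply (by fun_prop) (MeasurableSet.univ_pi hs)]
  have h : (fun (x : Fin N → ℝ) i => x (τ i)) ⁻¹' (Set.univ.pi s) =
      Set.univ.pi fun i => s (τ.symm i) := by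
    ext x
    simp only [Set.mem_preimage, Set.mem_univ_pi]
    exact ⟨fun hx i => by simpa using hx (τ.symm i), fun hx i => by simpa using hx (τ i)⟩
  rw [h, Measure.pi_pi]
  exact Equiv.prod_comp τ.symm fun i => gaussianReal 0 1 (s i)

theorem map_perm_gueEigenvalueLaw (τ : Equiv.Perm (Fin N)) :
    (gueEigenvalueLaw N).map (fun x i => x (τ i)) = gueEigenvalueLaw N := by
  have hm : Measurable fun (x : Fin N → ℝ) i => x (τ i) := by fun_prop
  ext s hs
  rw [Measure.map_apply hm hs, gueEigenvalueLaw, withDensity_apply _ (hm hs),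
    withDensity_apply _ hs]
  conv_rhs => rw [← map_perm_stdGaussianPi τ]
  rw [setLIntegral_map hs measurable_gueTilt.ennreal_ofReal hm]
  simp only [gueTilt, vandermondeProd_comp_perm_sq]

/-- Power-sum moments of the eigenvalue law satisfy the loop equations. -/
theorem exists_satisfiesLoopEquations_gueEigenvalueLaw (N : ℕ) :
    ∃ L : MvPolynomial ℕ ℂ →ₗ[ℂ] ℂ, SatisfiesLoopEquations N L ∧ ∀ f, L f =
      ∫ x : Fin N → ℝ, MvPolynomial.aeval (fun k : ℕ => ∑ i, (x i : ℂ) ^ k) f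
        ∂(gueEigenvalueLaw N) := by
  have hev : ∀ g : MvPolynomial (Fin N) ℂ,
      ((∏ k ∈ Finset.Icc 1 N, (k.factorial : ℝ))⁻¹ : ℂ) * gaussianExpectation (Fin N)
        ((vandermondeProd fun i => MvPolynomial.X i) ^ 2 * g) =
      ∫ x : Fin N → ℝ, MvPolynomial.eval (fun i => (x i : ℂ)) g ∂(gueEigenvalueLaw N) := by
    intro g
    rw [integral_gueEigenvalueLaw, gaussianExpectation_apply, ← integral_const_mul]
    refine integral_congr_ae (ae_of_all _ fun x => ?_)
    simp only [map_mul, map_pow, eval_vandermondeProd_X, Complex.real_smul, gueTilt]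
    push_cast
    ring
  refine ⟨_, satisfiesLoopEquations_of_vandermonde (fun i => MvPolynomial.X i)
    (fun i => MvPolynomial.pderiv i) (fun i j => ?_) (vandermondeProd fun i => MvPolynomial.X i)
    rfl (gaussianExpectation (Fin N)) gaussianExpectation_X_mul
    ((∏ k ∈ Finset.Icc 1 N, (k.factorial : ℝ))⁻¹ : ℂ) ?_, fun f => ?_⟩
  · rw [MvPolynomial.pderiv_X, Pi.single_apply]
    simp [eq_comm]
  · have h := hev 1
    have := isProbabilityMeasure_gueEigenvalueLaw N
    simpa using h
  · simp only [LinearMap.smul_apply, LinearMap.comp_apply, AlgHom.toLinearMap_apply,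
      LinearMap.mulLeft_apply, smul_eq_mul]
    rw [hev]
    refine integral_congr_ae (ae_of_all _ fun x => ?_)
    have hcomp : (MvPolynomial.aeval (R := ℂ) fun i => (x i : ℂ)).comp
        (MvPolynomial.aeval (R := ℂ) fun k : ℕ =>
          ∑ i : Fin N, (MvPolynomial.X i : MvPolynomial (Fin N) ℂ) ^ k) =
        MvPolynomial.aeval (fun k : ℕ => ∑ i, (x i : ℂ) ^ k) :=
      MvPolynomial.algHom_ext fun k => by simp
    exact DFunLike.congr_fun hcomp f

end Density

/-! ### The exchangeable spectrum and identification of the laws -/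

section ExchangeableSpectrum

variable {Ω : Type*} [MeasurableSpace Ω] {μ : Measure Ω} {N : ℕ}
  {X : Ω → Matrix (Fin N) (Fin N) ℂ}

theorem IsGUE.aemeasurable_hermitianCoord (hX : IsGUE X μ) :
    AEMeasurable (fun ω a => hermitianCoord (X ω) a) μ :=
  aemeasurable_pi_lambda _ fun a => (hX.gaussian a).aemeasurable

theorem IsGUE.measurable_eigenvalues_perm (hX : IsGUE X μ) (σ : Equiv.Perm (Fin N)) :
    Measurable fun ω i => (hX.hermitian ω).eigenvalues (σ i) := by
  have := measurable_eigenvalues hX.hermitian hX.measurable_entry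
  exact measurable_pi_lambda _ fun i => (measurable_pi_apply (σ i)).comp this

theorem IsGUE.map_hermitianCoord [IsProbabilityMeasure μ] (hX : IsGUE X μ) :
    μ.map (fun ω a => hermitianCoord (X ω) a) = stdGaussianPi (HermitianIndex N) := by
  rw [(iIndepFun_iff_map_fun_eq_pi_map fun a => (hX.gaussian a).aemeasurable).1 hX.indep]
  simp only [(hX.gaussian _).map_eq]

theorem Matrix.IsHermitian.sum_eigenvalues_sq {A : Matrix (Fin N) (Fin N) ℂ}
    (hA : A.IsHermitian) : ∑ i, hA.eigenvalues i ^ 2 = ∑ a, hermitianCoord A a ^ 2 := by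
  have h := hA.trace_pow_eq_sum_eigenvalues 2
  rw [trace_sq_eq_sum_hermitianCoord_sq hA] at h
  exact_mod_cast h.symm

theorem isProbabilityMeasure_exchangeableSpectrumLaw [IsProbabilityMeasure μ] (hX : IsGUE X μ) :
    IsProbabilityMeasure (exchangeableSpectrumLaw X hX.hermitian μ) := by
  refine ⟨?_⟩
  have h : ∀ σ : Equiv.Perm (Fin N),
      (μ.map fun ω i => (hX.hermitian ω).eigenvalues (σ i)) Set.univ = 1 := fun σ => by
    rw [Measure.map_apply (hX.measurable_eigenvalues_perm σ) MeasurableSet.univ, Set.preimage_univ,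
      measure_univ]
  rw [exchangeableSpectrumLaw, Measure.smul_apply, Measure.finsetSum_apply]
  simp only [h, Finset.sum_const, Finset.card_univ, Fintype.card_perm, Fintype.card_fin,
    smul_eq_mul, nsmul_eq_mul, mul_one]
  exact ENNReal.inv_mul_cancel (by exact_mod_cast N.factorial_ne_zero) (ENNReal.natCast_ne_top _)

theorem map_perm_exchangeableSpectrumLaw (hX : IsGUE X μ) (τ : Equiv.Perm (Fin N)) :
    (exchangeableSpectrumLaw X hX.hermitian μ).map (fun x i => x (τ i)) =
      exchangeableSpectrumLaw X hX.hermitian μ := by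
  have hm : Measurable fun (x : Fin N → ℝ) i => x (τ i) := by fun_prop
  rw [exchangeableSpectrumLaw, Measure.map_smul, Measure.map_finset_sum' hm.aemeasurable]
  congr 1
  refine Fintype.sum_equiv (Equiv.mulRight τ) _ _ fun σ => ?_
  rw [Measure.map_map hm (hX.measurable_eigenvalues_perm σ)]
  rfl

theorem integrable_exchangeableSpectrumLaw (hX : IsGUE X μ) {E : Type*} [NormedAddCommGroup E]
    {f : (Fin N → ℝ) → E} (hf : StronglyMeasurable f)
    (hfi : ∀ σ : Equiv.Perm (Fin N),
      Integrable (fun ω => f fun i => (hX.hermitian ω).eigenvalues (σ i)) μ) :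
    Integrable f (exchangeableSpectrumLaw X hX.hermitian μ) := by
  refine Integrable.smul_measure ?_ (ENNReal.inv_ne_top.2 (by exact_mod_cast N.factorial_ne_zero))
  rw [integrable_finsetSum_measure]
  intro σ _
  rw [integrable_map_measure hf.aestronglyMeasurable (hX.measurable_eigenvalues_perm σ).aemeasurable]
  exact hfi σ

theorem integral_exchangeableSpectrumLaw (hX : IsGUE X μ) {f : (Fin N → ℝ) → ℂ}
    (hf : StronglyMeasurable f) (hfi : Integrable f (exchangeableSpectrumLaw X hX.hermitian μ))
    (hfs : ∀ (σ : Equiv.Perm (Fin N)) x, f (fun i => x (σ i)) = f x) :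
    ∫ x, f x ∂(exchangeableSpectrumLaw X hX.hermitian μ) =
      ∫ ω, f (hX.hermitian ω).eigenvalues ∂μ := by
  have hN : ((N.factorial : ENNReal)⁻¹) ≠ 0 := ENNReal.inv_ne_zero.2 (ENNReal.natCast_ne_top _)
  have hN' : ((N.factorial : ENNReal)⁻¹) ≠ ⊤ :=
    ENNReal.inv_ne_top.2 (by exact_mod_cast N.factorial_ne_zero)
  rw [exchangeableSpectrumLaw] at hfi ⊢
  rw [integrable_smul_measure hN hN', integrable_finsetSum_measure] at hfi
  rw [integral_smul_measure, integral_finsetSum_measure hfi]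
  have h : ∀ σ : Equiv.Perm (Fin N),
      ∫ x, f x ∂(μ.map fun ω i => (hX.hermitian ω).eigenvalues (σ i)) =
        ∫ ω, f (hX.hermitian ω).eigenvalues ∂μ := fun σ => by
    rw [integral_map (hX.measurable_eigenvalues_perm σ).aemeasurable hf.aestronglyMeasurable]
    simp only [hfs σ]
  simp only [h, Finset.sum_const, Finset.card_univ, Fintype.card_perm, Fintype.card_fin]
  rw [← Nat.cast_smul_eq_nsmul ℝ, smul_smul]
  have : (N.factorial : ℝ) ≠ 0 := by exact_mod_cast N.factorial_ne_zero
  simp [this]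

theorem integrable_exp_sq_exchangeableSpectrumLaw [IsProbabilityMeasure μ] (hX : IsGUE X μ) :
    Integrable
    (fun x : Fin N → ℝ => Real.exp ((∑ i, x i ^ 2) / 8))
    (exchangeableSpectrumLaw X hX.hermitian μ) := by
  refine integrable_exchangeableSpectrumLaw hX
    (Continuous.stronglyMeasurable (by fun_prop)) fun σ => ?_
  have h := integrable_exp_sq_stdGaussianPi (σ := HermitianIndex N) (c := 1 / 8) (by norm_num)
  rw [← hX.map_hermitianCoord] at h
  refine (h.comp_aemeasurable hX.aemeasurable_hermitianCoord).congr (ae_of_all _ fun ω => ?_)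
  simp only [Function.comp_apply]
  rw [Equiv.sum_comp σ fun i => (hX.hermitian ω).eigenvalues i ^ 2,
    (hX.hermitian ω).sum_eigenvalues_sq]
  congr 1
  ring

/-- The power sums of the eigenvalues are traces of powers of `X ω`, which is the generic matrix
evaluated at coordinates of standard Gaussian law. -/
theorem integral_aeval_exchangeableSpectrumLaw [IsProbabilityMeasure μ] (hX : IsGUE X μ)
    (f : MvPolynomial ℕ ℂ) :
    ∫ x : Fin N → ℝ, MvPolynomial.aeval (fun k : ℕ => ∑ i, (x i : ℂ) ^ k) f
        ∂(exchangeableSpectrumLaw X hX.hermitian μ) =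
      gaussianExpectation (HermitianIndex N)
        (MvPolynomial.aeval (fun k => (genericHermitian N ^ k).trace) f) := by
  have hpoly : ∀ x : Fin N → ℝ, MvPolynomial.aeval (fun k : ℕ => ∑ i, (x i : ℂ) ^ k) f =
      MvPolynomial.eval (fun i => (x i : ℂ)) (MvPolynomial.aeval (R := ℂ) (fun k : ℕ =>
          ∑ i : Fin N, (MvPolynomial.X i : MvPolynomial (Fin N) ℂ) ^ k) f) := fun x => by
    have hcomp : (MvPolynomial.aeval (R := ℂ) fun i => (x i : ℂ)).comp
        (MvPolynomial.aeval (R := ℂ) fun k : ℕ =>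
          ∑ i : Fin N, (MvPolynomial.X i : MvPolynomial (Fin N) ℂ) ^ k) =
        MvPolynomial.aeval (fun k : ℕ => ∑ i, (x i : ℂ) ^ k) :=
      MvPolynomial.algHom_ext fun k => by simp
    exact (DFunLike.congr_fun hcomp f).symm
  have hmeas : StronglyMeasurable fun x : Fin N → ℝ =>
      MvPolynomial.aeval (fun k : ℕ => ∑ i, (x i : ℂ) ^ k) f := by
    simp only [hpoly]
    exact (measurable_eval_ofReal _).stronglyMeasurable
  rw [integral_exchangeableSpectrumLaw hX hmeas]
  · rw [gaussianExpectation_apply, ← hX.map_hermitianCoord,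
      integral_map hX.aemeasurable_hermitianCoord (measurable_eval_ofReal _).aestronglyMeasurable]
    refine integral_congr_ae (ae_of_all _ fun ω => ?_)
    have hcomp : (MvPolynomial.aeval (R := ℂ) fun a => (hermitianCoord (X ω) a : ℂ)).comp
        (MvPolynomial.aeval (R := ℂ) fun k => (genericHermitian N ^ k).trace) =
        MvPolynomial.aeval fun k : ℕ => ∑ i, ((hX.hermitian ω).eigenvalues i : ℂ) ^ k := by
      refine MvPolynomial.algHom_ext fun k => ?_
      rw [AlgHom.comp_apply, MvPolynomial.aeval_X, MvPolynomial.aeval_X,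
        ← (hX.hermitian ω).trace_pow_eq_sum_eigenvalues]
      conv_rhs => rw [← eval_genericHermitian (hX.hermitian ω)]
      rw [← Matrix.map_pow, ← AddMonoidHom.map_trace]
      rfl
    exact (DFunLike.congr_fun hcomp f).symm
  · simp only [hpoly]
    exact integrable_eval_of_integrable_exp_sq (integrable_exp_sq_exchangeableSpectrumLaw hX) _
  · intro σ x
    congr 2
    ext1 k
    exact Equiv.sum_comp σ fun i => (x i : ℂ) ^ k

theorem exchangeableSpectrumLaw_eq_gueEigenvalueLaw [IsProbabilityMeasure μ] (hX : IsGUE X μ) :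
    exchangeableSpectrumLaw X hX.hermitian μ = gueEigenvalueLaw N := by
  have := isProbabilityMeasure_exchangeableSpectrumLaw hX
  have := isProbabilityMeasure_gueEigenvalueLaw N
  have h1 := integrable_exp_sq_exchangeableSpectrumLaw hX
  have h2 := integrable_exp_sq_gueEigenvalueLaw N
  refine Measure.ext_of_psum_eq (integrable_exp_sum_mul_of_integrable_exp_sq h1)
    (integrable_exp_sum_mul_of_integrable_exp_sq h2) (integrable_eval_of_integrable_exp_sq h1)
    (integrable_eval_of_integrable_exp_sq h2) (map_perm_exchangeableSpectrumLaw hX)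
    map_perm_gueEigenvalueLaw fun f => ?_
  obtain ⟨L, hL, hLf⟩ := exists_satisfiesLoopEquations_gueEigenvalueLaw N
  rw [integral_aeval_exchangeableSpectrumLaw hX, ← hLf,
    hL.unique (satisfiesLoopEquations_genericHermitian N)]
  rfl

/-- Two vectors that list the same multiset differ by a permutation. -/
theorem exists_perm_of_map_univ_eq {x y : Fin N → ℝ}
    (h : (Finset.univ : Finset (Fin N)).val.map x = (Finset.univ : Finset (Fin N)).val.map y) :
    ∃ τ : Equiv.Perm (Fin N), ∀ i, x i = y (τ i) := by
  have hperm : (List.ofFn x).Perm (List.ofFn y) := by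
    rwa [Fin.univ_val_map, Fin.univ_val_map, Multiset.coe_eq_coe] at h
  have hxy : x ∘ Tuple.sort x = y ∘ Tuple.sort y := by
    refine List.ofFn_injective (List.Perm.eq_of_sortedLE
      (Tuple.monotone_sort x).sortedLE_ofFn (Tuple.monotone_sort y).sortedLE_ofFn ?_)
    exact ((Equiv.Perm.ofFn_comp_perm _ x).trans hperm).trans (Equiv.Perm.ofFn_comp_perm _ y).symm
  refine ⟨(Tuple.sort x).symm.trans (Tuple.sort y), fun i => ?_⟩
  simpa using congrFun hxy ((Tuple.sort x).symm i)

/-- Summing over all permutations forgets the order of the listing; exchangeability turns the sum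
for `L` into `N!` copies of its law. -/
theorem IsExchangeableSpectrum.map_eq_exchangeableSpectrumLaw (hX : IsGUE X μ)
    {L : Ω → Fin N → ℝ} (hL : IsExchangeableSpectrum X L μ) :
    μ.map L = exchangeableSpectrumLaw X hX.hermitian μ := by
  have hLm : ∀ σ : Equiv.Perm (Fin N), AEMeasurable (fun ω i => L ω (σ i)) μ := fun σ =>
    Measurable.comp_aemeasurable (g := fun (x : Fin N → ℝ) i => x (σ i)) (by fun_prop)
      hL.aemeasurable
  have hsum : ∑ σ : Equiv.Perm (Fin N), μ.map (fun ω i => L ω (σ i)) =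
      ∑ σ : Equiv.Perm (Fin N), μ.map (fun ω i => (hX.hermitian ω).eigenvalues (σ i)) := by
    ext s hs
    have hind : Measurable (s.indicator (1 : (Fin N → ℝ) → ENNReal)) :=
      measurable_one.indicator hs
    -- With the sum inside the integral the comparison is pointwise, so the permutation relating `L
    -- ω` to the eigenvalues need not depend measurably on `ω`.
    have key : ∀ F : Equiv.Perm (Fin N) → Ω → Fin N → ℝ, (∀ σ, AEMeasurable (F σ) μ) →
        (∑ σ, μ.map (F σ)) s = ∫⁻ ω, ∑ σ, s.indicator 1 (F σ ω) ∂μ := fun F hF => by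
      rw [Measure.finsetSum_apply, lintegral_finsetSum' (f := fun σ ω =>
        s.indicator 1 (F σ ω)) _ fun σ _ => hind.comp_aemeasurable (hF σ)]
      refine Finset.sum_congr rfl fun σ _ => ?_
      rw [← lintegral_indicator_one hs, lintegral_map' hind.aemeasurable (hF σ)]
    rw [key _ hLm, key _ fun σ => (hX.measurable_eigenvalues_perm σ).aemeasurable]
    refine lintegral_congr_ae ?_
    filter_upwards [hL.lists_eigenvalues] with ω hω
    rw [(hX.hermitian ω).roots_charpoly_eq_eigenvalues] at hω
    have hω' := congrArg (Multiset.map Complex.re) hω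
    rw [Multiset.map_map, Multiset.map_map] at hω'
    obtain ⟨τ, hτ⟩ := exists_perm_of_map_univ_eq (x := L ω) (y := (hX.hermitian ω).eigenvalues)
      hω'.symm
    simp only [hτ]
    exact Fintype.sum_equiv (Equiv.mulLeft τ) _ _ fun σ => rfl
  rw [exchangeableSpectrumLaw, ← hsum]
  simp only [hL.exchangeable, Finset.sum_const, Finset.card_univ, Fintype.card_perm,
    Fintype.card_fin]
  rw [← Nat.cast_smul_eq_nsmul ENNReal, smul_smul, ENNReal.inv_mul_cancel
    (by exact_mod_cast N.factorial_ne_zero) (ENNReal.natCast_ne_top _), one_smul]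

end ExchangeableSpectrum

theorem mainTheorem5 {Ω : Type*} [MeasurableSpace Ω] (μ : Measure Ω) [IsProbabilityMeasure μ]
    (N : ℕ) (hN : 1 ≤ N) (X : Ω → Matrix (Fin N) (Fin N) ℂ) (hX : IsGUE X μ) :
    exchangeableSpectrumLaw X hX.hermitian μ =
        (volume : Measure (Fin N → ℝ)).withDensity
          (fun x => ENNReal.ofReal (gueEigenvalueDensity N x)) ∧
      ∀ L : Ω → Fin N → ℝ, IsExchangeableSpectrum X L μ →
        HasLaw L ((volume : Measure (Fin N → ℝ)).withDensity
          (fun x => ENNReal.ofReal (gueEigenvalueDensity N x))) μ := by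
  have h : exchangeableSpectrumLaw X hX.hermitian μ =
      (volume : Measure (Fin N → ℝ)).withDensity
        (fun x => ENNReal.ofReal (gueEigenvalueDensity N x)) := by
    rw [exchangeableSpectrumLaw_eq_gueEigenvalueLaw hX, withDensity_gueEigenvalueDensity]
    rfl
  exact ⟨h, fun L hL => ⟨hL.aemeasurable, (hL.map_eq_exchangeableSpectrumLaw hX).trans h⟩⟩
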